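/- **Setting.** Let $\mathcal M=(\mathcal S,\mathcal A,\mathcal P,c,\gamma)$ be a discounted Markov decision process with finite nonempty state space $\mathcal S$, finite action space $\mathcal A$ with $|\mathcal A|\ge 2$, costs $0\le c\le 1$ and discount $\gamma\in(0,1)$. Put $\mathcal Z=\mathcal S\times\mathcal A$ and $M=\frac1{1-\gamma}$. For a policy $\pi:\mathcal S\to\Delta_{\mathcal A}$ let $V^\pi(s)=\mathbb E[\sum_{t\ge0}\gamma^t c(S_t,A_t)\mid S_0=s]$, with $A_t\sim\pi(\cdot|S_t)$ and $S_{t+1}\sim\mathcal P(\cdot|S_t,A_t)$, and $f_\vartheta(\pi)=\mathbb E_{s\sim\vartheta}V^\pi(s)$ for $\vartheta\in\Delta_{\mathcal S}$. A policy $\pi^*$ is optimal if $V^{\pi^*}(s)\le V^\pi(s)$ for all $s$ and all $\pi$. **Algorithm.** Start from the uniform policy $\pi_0$. At iteration $t$, generate $m$ trajectories $(Z_0^{(l)},\dots,Z_{n-1}^{(l)})$ of the state-action chain of $\pi_t$, from arbitrary starting pairs $Z^{(l)}_0$ (which may be random and depend on earlier iterations), independent given the starting pairs and the past. For $z\in\mathcal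 Z$ let $\hat Q_{(l)}(z)=\sum_{i=T}^{n-1}\gamma^{i-T}c(Z_i^{(l)})$, where $T$ is the first visit time of trajectory $l$ to $z$, and $\hat Q_{(l)}(z)=0$ if $z$ is not visited. The truncated on-policy Monte Carlo (TOMC) estimator with threshold $\tau$ is $$\tilde Q_t(s,a)=\tfrac1m\textstyle\sum_{l}\hat Q_{(l)}(s,a)\ \text{ if }\pi_t(a|s)\ge\tau,\qquad \tilde Q_t(s,a)=\tfrac1{1-\gamma}\ \text{ if }\pi_t(a|s)<\tau .$$ Stochastic policy mirror descent (SPMD) with the KL divergence and stepsize $\eta$ sets $$\pi_{t+1}(\cdot|s)=\operatorname*{argmin}_{p\in\Delta_{\mathcal A}}\ \eta\langle\tilde Q_t(s,\cdot),p\rangle+\textstyle\sum_{a}p(a)\log\frac{p(a)}{\pi_t(a|s)},\qquad s\in\mathcal S.$$ **Assumption (uniform mixing and state exploration), with constants $C\ge1$, $\rho\in(0,1)$, $\underline\nu>0$.** Almost surely, for each of the policies $\pi=\pi_0,\dots,\pi_k$ generated in $k$ iterations, the state chain of $\pi$ has a stationary distribution $\nu^\pi$ with $\nu^\pi(s)\ge\underline\nu$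 for all $s$, and $\sum_{s}|\mathbb P^\pi(S_t=s\mid S_0=s_0)-\nu^\pi(s)|\le C\rho^{t+1}$ for all $s_0$ and all $t\ge0$. **Proposition.** A quantity is called $\tilde{\mathcal O}(X)$ (resp. $\tilde\Theta(X)$, $\Theta(X)$ for a prescribed parameter) with absolute constants $b,p$: $\tilde{\mathcal O}(X)$ means at most $b\,X\log^{p}(e+|X|)$; a parameter prescribed as $\tilde\Theta(X)$ (resp. $\Theta(X)$) may be any integer that is at least $b\,X\log^{p}(e+|X|)$ (resp. $b\,X$). There are absolute constants $b,p$ in the prescriptions and bounds below, not depending on the MDP or on any parameter, such that the following holds. An optimal policy $\pi^*$ exists. For $k\ge1$ and $\delta\in(0,1)$ put $$\eta=\sqrt{\tfrac{\log|\mathcal A|}{2kM^2}},\quad \tau=|\mathcal A|^{-2/(1-\gamma)},\quad \varepsilon=M\sqrt{\tfrac{\log|\mathcal A|}{2k}},\quad t_{\mathrm{mix}}=\Big\lceil \log_\rho\tfrac{\underline\nu}{2C}-\tfrac{2\log_\rho|\mathcal A|}{1-\gamma}\Big\rceil,$$ $$m=\Theta\Big(\tfrac{|\mathcal A|^2}{(1-\gamma)^2\varepsilon^2}\log\tfrac{2|\mathcal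 Z|k}{\delta}\Big),\qquad n=\tilde\Theta\Big(\big(\tfrac1{1-\gamma}+\tfrac{t_{\mathrm{mix}}}{\underline\nu}|\mathcal A|^{2/(1-\gamma)}\big)\log\tfrac{|\mathcal A|}{\varepsilon}\Big),\quad n\ge1.$$ (1) If the run of SPMD with the TOMC estimator and these parameters satisfies the Assumption, then with probability at least $1-\delta$, simultaneously for all $\vartheta\in\Delta_{\mathcal S}$, $$\min_{0\le t\le k-1}f_\vartheta(\pi_t)-f_\vartheta(\pi^*)\le\frac{3M}{1-\gamma}\sqrt{\frac{2\log|\mathcal A|}{k}} .$$ (2) Let $0<\epsilon\le1$, take $k=\Big\lceil\frac{18\log|\mathcal A|}{(1-\gamma)^4\epsilon^2}\Big\rceil$, and let $m$ and $n$ be the least integers allowed by the prescriptions above. If the run satisfies the Assumption, then with probability at least $1-\delta$, simultaneously for all $\vartheta$, $\min_{0\le t\le k-1}f_\vartheta(\pi_t)-f_\vartheta(\pi^*)\le\epsilon$, and the total number of samples $k\cdot m\cdot n$ is $$\tilde{\mathcal O}\Big(\tfrac{|\mathcal A|^2\log|\mathcal A|}{(1-\gamma)^6\epsilon^4}\Big(\tfrac1{1-\gamma}+\tfrac{t_{\mathrm{mix}}}{\underline\nu}|\mathcal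 A|^{2/(1-\gamma)}\Big)\log\Big(\tfrac{36|\mathcal Z|\log|\mathcal A|}{\delta(1-\gamma)^4}\Big)\log\tfrac{|\mathcal A|}{\epsilon}\Big).$$ -/

import Mathlib

namespace PolicyMirrorDescent

/-- A finite discounted Markov decision process with costs in `[0, 1]`. -/
structure MDP (S A : Type*) [Fintype S] where
  /-- transition kernel: `P s a` is the law of the next state -/
  P : S → A → stdSimplex ℝ S
  /-- cost function -/
  c : S → A → ℝ
  /-- discount factor -/
  γ : ℝ
  c_nonneg : ∀ s a, 0 ≤ c s a
  c_le_one : ∀ s a, c s a ≤ 1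
  γ_pos : 0 < γ
  γ_lt_one : γ < 1

/-- Randomized stationary policies. -/
abbrev Policy (S A : Type*) [Fintype A] := S → stdSimplex ℝ A

/-! ### Values -/

section Values

variable {S A : Type*} [Fintype S] [Fintype A] [DecidableEq S]

/-- The state transition matrix `s, s' ↦ ∑ a, π(a|s) P(s'|s,a)` of the policy `π`. -/
noncomputable def MDP.stateMatrix (M : MDP S A) (π : Policy S A) : Matrix S S ℝ :=
  fun s s' => ∑ a, π s a * M.P s a s'

/-- The value function `V^π(s) = ∑ t, γ^t E[c(S_t, A_t) | S_0 = s]`, where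
`P(S_t = s' | S_0 = s)` is the `(s, s')` entry of the `t`-th power of the transition matrix. -/
noncomputable def MDP.value (M : MDP S A) (π : Policy S A) (s : S) : ℝ :=
  ∑' t : ℕ, M.γ ^ t * ∑ s', (M.stateMatrix π ^ t) s s' * ∑ a, π s' a * M.c s' a

/-- The objective `f(π) = E_{s ∼ θ} V^π(s)`. -/
noncomputable def MDP.objective (M : MDP S A) (θ : stdSimplex ℝ S) (π : Policy S A) : ℝ :=
  ∑ s, θ s * M.value π s

/-- `π` is an optimal policy. -/
def MDP.IsOptimal (M : MDP S A) (π : Policy S A) : Prop :=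
  ∀ (π' : Policy S A) (s : S), M.value π s ≤ M.value π' s

/-- The state chain of `π` has a stationary distribution with all masses at least `νmin`, and it
mixes geometrically with constants `(C, ρ)` from every initial state. -/
def MDP.MixingExploring (M : MDP S A) (π : Policy S A) (C ρ νmin : ℝ) : Prop :=
  ∃ ν : stdSimplex ℝ S,
    (∀ s, ν s = ∑ s', ν s' * M.stateMatrix π s' s) ∧
    (∀ (s₀ : S) (t : ℕ), ∑ s, |(M.stateMatrix π ^ t) s₀ s - ν s| ≤ C * ρ ^ (t + 1)) ∧
    ∀ s, νmin ≤ ν s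

end Values

/-! ### Sampling trajectories -/

/-- A point of the probability simplex as a probability mass function. -/
noncomputable def simplexPMF {α : Type*} [Fintype α] (p : stdSimplex ℝ α) : PMF α :=
  PMF.ofFintype (fun a => ENNReal.ofReal (p a)) (by
    have h : ∑ a, p a = 1 := p.2.2
    have h' : ∀ a ∈ Finset.univ, 0 ≤ p a := fun a _ => p.2.1 a
    rw [← ENNReal.ofReal_sum_of_nonneg h', h, ENNReal.ofReal_one])

/-- The joint law of independent random variables with laws `p i`. -/
noncomputable def productPMF {ι α : Type*} [Fintype ι] [DecidableEq ι] [Fintype α]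
    (p : ι → PMF α) : PMF (ι → α) :=
  PMF.ofFintype (fun x => ∏ i, p i (x i)) (by
    have h : ∀ i, ∑ a, p i a = 1 := fun i => by
      rw [← tsum_fintype (L := .unconditional _)]
      exact (p i).tsum_coe
    rw [← Fintype.prod_sum]
    simp [h])

/-- A batch of `m` trajectories of length `n`. -/
abbrev Batch (S A : Type*) (m n : ℕ) := Fin m → Fin n → S × A

section Sampling

variable {S A : Type*} [Fintype S] [Fintype A]

/-- One transition of the state-action chain of `π`: `S' ∼ P(·|s,a)`, then `A' ∼ π(·|S')`. -/
noncomputable def MDP.step (M : MDP S A) (π : Policy S A) (z : S × A) : PMF (S × A) :=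
  (simplexPMF (M.P z.1 z.2)).bind fun s' => (simplexPMF (π s')).map fun a' => (s', a')

/-- The law of the trajectory `(Z_0, …, Z_{n-1})` of the state-action chain with `Z_0 = z`. -/
noncomputable def MDP.trajectoryLaw (M : MDP S A) (π : Policy S A) :
    (n : ℕ) → S × A → PMF (Fin n → S × A)
  | 0, _ => PMF.pure Fin.elim0
  | n + 1, z => (M.step π z).bind fun z' => (M.trajectoryLaw π n z').map fun ξ => Fin.cons z ξ

/-- The law of a batch: the `m` starting pairs are drawn from `init`, and given these the `m`
trajectories are independent. -/
noncomputable def MDP.batchLaw (M : MDP S A) (π : Policy S A) {m : ℕ} (n : ℕ)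
    (init : PMF (Fin m → S × A)) : PMF (Batch S A m n) :=
  init.bind fun z => productPMF fun l => M.trajectoryLaw π n (z l)

end Sampling

/-! ### Truncated on-policy Monte Carlo -/

section Estimator

variable {S A : Type*} [Fintype S] [Fintype A]

/-- The first time at which the trajectory visits `z`, and `n` if there is no such time. -/
noncomputable def hitTime {S A : Type*} {n : ℕ} (ξ : Fin n → S × A) (z : S × A) : ℕ :=
  sInf {t : ℕ | t = n ∨ ∃ h : t < n, ξ ⟨t, h⟩ = z}

/-- The discounted cost collected from the first visit to `z` on; the sum is empty, hence `0`, if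
`z` is not visited. -/
noncomputable def MDP.singleEstimate (M : MDP S A) {n : ℕ} (ξ : Fin n → S × A) (z : S × A) : ℝ :=
  ∑ t ∈ (Finset.univ : Finset (Fin n)).filter (fun t : Fin n => hitTime ξ z ≤ (t : ℕ)),
    M.γ ^ ((t : ℕ) - hitTime ξ z) * M.c (ξ t).1 (ξ t).2

/-- The on-policy Monte Carlo estimator: the average over the batch. -/
noncomputable def MDP.omc (M : MDP S A) {m n : ℕ} (b : Batch S A m n) (z : S × A) : ℝ :=
  (1 / (m : ℝ)) * ∑ l, M.singleEstimate (b l) z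

open Classical in
/-- The truncated on-policy Monte Carlo estimator with threshold `τ`. -/
noncomputable def MDP.tomc (M : MDP S A) (τ : ℝ) (π : Policy S A) {m n : ℕ} (b : Batch S A m n)
    (s : S) (a : A) : ℝ :=
  if τ ≤ π s a then M.omc b (s, a) else 1 / (1 - M.γ)

end Estimator

/-! ### Stochastic policy mirror descent -/

section Descent

variable {S A : Type*} [Fintype S] [Fintype A]

/-- The Kullback–Leibler divergence, with `0 log 0 = 0`. It is only used with a second argument
all of whose entries are positive: the iteration starts at the uniform policy and its updates
keep all entries positive. -/
noncomputable def kl (p q : stdSimplex ℝ A) : ℝ :=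
  ∑ a, p a * Real.log (p a / q a)

/-- The mirror descent step
`argmin_{p} η ⟨Q, p⟩ + D(p, q)` over the probability simplex. -/
noncomputable def mirrorStep [Nonempty A] (η : ℝ) (Q : A → ℝ) (q : stdSimplex ℝ A) :
    stdSimplex ℝ A :=
  Classical.epsilon fun p => ∀ p' : stdSimplex ℝ A,
    η * ∑ a, Q a * p a + kl p q ≤ η * ∑ a, Q a * p' a + kl p' q

/-- The policy obtained from the batches in the list `h` (oldest batch first), starting from the
uniform policy, with constant stepsize `η` and truncation threshold `τ`. -/
noncomputable def MDP.policyAfter [Nonempty A] (M : MDP S A) (η τ : ℝ) {m n : ℕ}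
    (h : List (Batch S A m n)) : Policy S A :=
  h.foldl (fun π b s => mirrorStep η (M.tomc τ π b s) (π s)) fun _ => stdSimplex.barycenter

/-- The law of the list of batches (oldest first) used in the first `k` iterations. At each
iteration a batch is generated with the current policy; its starting pairs are arbitrary, that
is, they follow any law `init h` that may depend on the list `h` of all earlier batches. -/
noncomputable def MDP.runLaw [Nonempty A] (M : MDP S A) (η τ : ℝ) {m n : ℕ}
    (init : List (Batch S A m n) → PMF (Fin m → S × A)) : ℕ → PMF (List (Batch S A m n))
  | 0 => PMF.pure []
  | k + 1 => (M.runLaw η τ init k).bind fun h =>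
      (M.batchLaw (M.policyAfter η τ h) n (init h)).map fun b => h ++ [b]

/-- The iterate `π_t` in a run with batches `h`. -/
noncomputable def MDP.iterate [Nonempty A] (M : MDP S A) (η τ : ℝ) {m n : ℕ}
    (h : List (Batch S A m n)) (t : ℕ) : Policy S A :=
  M.policyAfter η τ (h.take t)

/-- Almost surely, all policies `π_0, …, π_k` generated in `k` iterations are mixing and exploring
over the state space with the common constants `(C, ρ, νmin)`. -/
def MDP.UniformlyMixing [Nonempty A] [DecidableEq S] (M : MDP S A) (η τ : ℝ) {m n : ℕ}
    (init : List (Batch S A m n) → PMF (Fin m → S × A)) (k : ℕ) (C ρ νmin : ℝ) : Prop :=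
  ∀ h ∈ (M.runLaw η τ init k).support, ∀ t ≤ k,
    M.MixingExploring (M.iterate η τ h t) C ρ νmin

/-- The event that, for every `θ`, the best-iterate gap
`min_{0 ≤ t ≤ k-1} f(π_t) - f(π*)` is at most `r`. -/
def MDP.gapEvent [Nonempty A] [DecidableEq S] (M : MDP S A) (η τ : ℝ) (m n k : ℕ)
    (πstar : Policy S A) (r : ℝ) : Set (List (Batch S A m n)) :=
  {h | ∀ θ : stdSimplex ℝ S,
    (⨅ t : Fin k, M.objective θ (M.iterate η τ h t)) - M.objective θ πstar ≤ r}

end Descent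

/-! ### Parameters

Here `nA`, `nZ` are the numbers of actions and of state-action pairs. -/

/-- The stepsize `√(log nA / (2 k M²))` with `M = 1 / (1 - γ)`. -/
noncomputable def stepsize (nA : ℕ) (γ : ℝ) (k : ℕ) : ℝ :=
  √(Real.log nA / (2 * k * (1 / (1 - γ)) ^ 2))

/-- The truncation threshold `nA ^ (-2 / (1 - γ))`. -/
noncomputable def threshold (nA : ℕ) (γ : ℝ) : ℝ :=
  (nA : ℝ) ^ (-2 / (1 - γ))

/-- The noise level `ε = M √(log nA / (2 k))` with `M = 1 / (1 - γ)`. -/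
noncomputable def noiseLevel (nA : ℕ) (γ : ℝ) (k : ℕ) : ℝ :=
  1 / (1 - γ) * √(Real.log nA / (2 * k))

/-- `⌈log_ρ (νmin / (2 C)) - 2 log_ρ nA / (1 - γ)⌉`. -/
noncomputable def mixTime (nA : ℕ) (γ C ρ νmin : ℝ) : ℤ :=
  ⌈Real.logb ρ (νmin / (2 * C)) - 2 * Real.logb ρ nA / (1 - γ)⌉

/-- `1 / (1 - γ) + (t_mix / νmin) nA ^ (2 / (1 - γ))`. -/
noncomputable def horizonFactor (nA : ℕ) (γ C ρ νmin : ℝ) : ℝ :=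
  1 / (1 - γ) + (mixTime nA γ C ρ νmin : ℝ) / νmin * (nA : ℝ) ^ (2 / (1 - γ))

/-- The order of the number of trajectories per iteration. -/
noncomputable def trajectoryScale (nA nZ : ℕ) (γ δ : ℝ) (k : ℕ) : ℝ :=
  (nA : ℝ) ^ 2 / ((1 - γ) ^ 2 * noiseLevel nA γ k ^ 2) * Real.log (2 * nZ * k / δ)

/-- The order, up to logarithmic factors, of the length of the trajectories. -/
noncomputable def lengthScale (nA : ℕ) (γ C ρ νmin : ℝ) (k : ℕ) : ℝ :=
  horizonFactor nA γ C ρ νmin * Real.log (nA / noiseLevel nA γ k)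

/-- `k = 18 log nA / ((1 - γ)⁴ ϵ²)`, rounded up: the number of iterations for which
`3 M / (1 - γ) √(2 log nA / k) ≤ ϵ`. -/
noncomputable def iterationCount (nA : ℕ) (γ ϵ : ℝ) : ℕ :=
  ⌈18 * Real.log nA / ((1 - γ) ^ 4 * ϵ ^ 2)⌉₊

/-- The order, up to logarithmic factors, of the total number of samples. -/
noncomputable def sampleScale (nA nZ : ℕ) (γ C ρ νmin δ ϵ : ℝ) : ℝ :=
  (nA : ℝ) ^ 2 * Real.log nA / ((1 - γ) ^ 6 * ϵ ^ 4) * horizonFactor nA γ C ρ νmin *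
    Real.log (36 * nZ * Real.log nA / (δ * (1 - γ) ^ 4)) * Real.log (nA / ϵ)

/-- `c X log^p (e + |X|)`: a quantity is `Õ(X)` if it is at most this for absolute constants
`c > 0` and `p`. -/
noncomputable def softScale (c : ℝ) (p : ℕ) (X : ℝ) : ℝ :=
  c * X * Real.log (Real.exp 1 + |X|) ^ p

end PolicyMirrorDescent

open PolicyMirrorDescent

namespace PolicyMirrorDescent

open Finset

/-! ### Values, Bellman equations and optimal policies -/

section Basics

variable {S A : Type*} [Fintype S]

/-! With the KL divergence the mirror descent step is the multiplicative weights update, run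
separately in each state. Write `D = 1 / (1 - γ)`, let `g` choose an optimal action in each state,
and let `W_t(s)` be the sum over `i < t` of `V^{π_i}(s) - V^*(s)`. The usual potential argument
bounds `-log π_t(g s | s)` plus `η` times the sum of `V^{π_i}(s) - Q^{π_i}(s, g s)` by a constant
`G`. Since `V^{π_i}(s) - Q^{π_i}(s, g s)` is `V^{π_i} - V^*` at `s` minus `γ` times its average over
the successors under `g s`, this reads `-log π_t(g s | s) + η W_t(s) ≤ G + η γ (P_g W_t)(s)`.

This one inequality is used twice. Dropping the logarithm and evaluating at the maximum of `W_t`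
gives `W_t ≤ G D / η`, the regret bound, valid for every initial distribution because it is
pointwise in the state. Dropping `W_t ≥ 0` on the left instead, and inserting the regret bound on
the right, gives `-log π_t(g s | s) ≤ G D`. With `G = 2 log |A|` this says `π_t(g s | s) ≥ τ`:
optimal actions are never truncated. The induction closes because the inequality at time `t` needs
accurate estimates of optimal actions only before `t`. Truncating other actions is harmless: their
estimate `D` is an overestimate, and the argument needs only a lower bound on the estimates of
competing actions (`MDP.TruncatedDescent.log_bound`, `MDP.TruncatedDescent.regret_le`).

It remains to estimate `Q^π(z)` within `ε / 4` for all untruncated `z`. Mixing and `π(a|s) ≥ τ` make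
every block of `t_mix` steps hit `z` with probability at least `νmin τ / 2`, so a missed or late
first visit is exponentially unlikely and the bias is at most `ε / 8` (`MDP.avoid_le_pow`,
`MDP.MixingExploring.bias_le`). A Chernoff bound over the `m` trajectories controls the fluctuation
by `ε / 8`, with union bounds over pairs and iterations (`productPMF_mean_deviation`,
`MDP.runLaw_hasBadBatch`). The best iterate is at least as good as the average one, which turns
regret into the gap.

In the sample count, `k m n` carries `D ^ 8` against `D ^ 6` in the stated scale. The surplus `D ^
2` is logarithmic, since the scale contains `|A| ^ (2 D)`. -/

theorem simplex_nonneg {α : Type*} [Fintype α] (p : stdSimplex ℝ α) (a : α) : 0 ≤ p a := p.2.1 a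

theorem simplex_sum {α : Type*} [Fintype α] (p : stdSimplex ℝ α) : ∑ a, p a = 1 := p.2.2

theorem simplex_le_one {α : Type*} [Fintype α] (p : stdSimplex ℝ α) (a : α) : p a ≤ 1 := by
  rw [← simplex_sum p]
  exact single_le_sum (fun i _ => simplex_nonneg p i) (mem_univ a)

theorem simplex_sum_mul_le {α : Type*} [Fintype α] (p : stdSimplex ℝ α) {f : α → ℝ} {b : ℝ}
    (h : ∀ a, f a ≤ b) : ∑ a, p a * f a ≤ b := by
  calc ∑ a, p a * f a ≤ ∑ a, p a * b :=
        sum_le_sum fun a _ => mul_le_mul_of_nonneg_left (h a) (simplex_nonneg p a)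
    _ = b := by rw [← sum_mul, simplex_sum, one_mul]

theorem le_simplex_sum_mul {α : Type*} [Fintype α] (p : stdSimplex ℝ α) {f : α → ℝ} {b : ℝ}
    (h : ∀ a, b ≤ f a) : b ≤ ∑ a, p a * f a := by
  calc b = ∑ a, p a * b := by rw [← sum_mul, simplex_sum, one_mul]
    _ ≤ ∑ a, p a * f a :=
        sum_le_sum fun a _ => mul_le_mul_of_nonneg_left (h a) (simplex_nonneg p a)

theorem MDP.one_sub_pos (M : MDP S A) : 0 < 1 - M.γ := sub_pos.2 M.γ_lt_one

theorem MDP.one_le_horizon (M : MDP S A) : 1 ≤ 1 / (1 - M.γ) := by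
  rw [le_div_iff₀ M.one_sub_pos]; linarith [M.γ_pos]

theorem MDP.horizon_pos (M : MDP S A) : 0 < 1 / (1 - M.γ) := by linarith [M.one_le_horizon]

theorem MDP.one_add_mul_horizon (M : MDP S A) :
    1 + M.γ * (1 / (1 - M.γ)) = 1 / (1 - M.γ) := by
  have := M.one_sub_pos
  field_simp; ring

variable [Fintype A]

theorem MDP.stateMatrix_mulVec (M : MDP S A) (π : Policy S A) (v : S → ℝ) (s : S) :
    ∑ s', M.stateMatrix π s s' * v s' = ∑ a, π s a * ∑ s', M.P s a s' * v s' := by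
  simp only [MDP.stateMatrix, sum_mul, mul_sum]
  rw [sum_comm]
  simp only [mul_assoc]

theorem MDP.stateMatrix_nonneg (M : MDP S A) (π : Policy S A) (s s' : S) :
    0 ≤ M.stateMatrix π s s' :=
  sum_nonneg fun a _ => mul_nonneg (simplex_nonneg _ a) (simplex_nonneg _ s')

theorem MDP.stateMatrix_sum (M : MDP S A) (π : Policy S A) (s : S) :
    ∑ s', M.stateMatrix π s s' = 1 := by
  have := M.stateMatrix_mulVec π (fun _ => 1) s
  simpa [simplex_sum] using this

/-- A function dominated by its discounted average is nonpositive. -/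
theorem nonpos_of_le_discounted [Nonempty S] {γ : ℝ} (hγ : 0 ≤ γ) (hγ' : γ < 1)
    (P : S → stdSimplex ℝ S) (W : S → ℝ) (h : ∀ s, W s ≤ γ * ∑ s', P s s' * W s') (s : S) :
    W s ≤ 0 := by
  obtain ⟨s₀, hs₀⟩ := Finite.exists_max W
  have h1 : W s₀ ≤ γ * W s₀ :=
    (h s₀).trans (mul_le_mul_of_nonneg_left (simplex_sum_mul_le _ hs₀) hγ)
  have h2 : W s₀ ≤ 0 := by nlinarith
  exact (hs₀ s).trans h2

theorem MDP.average_cost_mem (M : MDP S A) (π : Policy S A) (s : S) :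
    0 ≤ ∑ a, π s a * M.c s a ∧ ∑ a, π s a * M.c s a ≤ 1 :=
  ⟨le_simplex_sum_mul _ (M.c_nonneg s), simplex_sum_mul_le _ (M.c_le_one s)⟩

/-- The row of the state transition matrix of `π` as a point of the simplex. -/
noncomputable def MDP.stateRow (M : MDP S A) (π : Policy S A) (s : S) : stdSimplex ℝ S :=
  ⟨M.stateMatrix π s, M.stateMatrix_nonneg π s, M.stateMatrix_sum π s⟩

theorem MDP.stateRow_apply (M : MDP S A) (π : Policy S A) (s s' : S) :
    M.stateRow π s s' = M.stateMatrix π s s' := rfl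

/-- The Bellman optimality operator. -/
noncomputable def MDP.bellman [Nonempty A] (M : MDP S A) (v : S → ℝ) (s : S) : ℝ :=
  univ.inf' univ_nonempty fun a => M.c s a + M.γ * ∑ s', M.P s a s' * v s'

theorem MDP.bellman_le_add [Nonempty A] (M : MDP S A) {v w : S → ℝ} {b : ℝ}
    (h : ∀ s, v s ≤ w s + b) (s : S) : M.bellman v s ≤ M.bellman w s + M.γ * b := by
  obtain ⟨a, -, ha⟩ := exists_mem_eq_inf' univ_nonempty
    fun a => M.c s a + M.γ * ∑ s', M.P s a s' * w s'
  have h1 : M.bellman v s ≤ M.c s a + M.γ * ∑ s', M.P s a s' * v s' := inf'_le _ (mem_univ a)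
  have h2 : ∑ s', M.P s a s' * (v s' - w s') ≤ b :=
    simplex_sum_mul_le _ fun s' => by linarith [h s']
  simp_rw [mul_sub, sum_sub_distrib] at h2
  have h3 : M.bellman w s = _ := ha
  rw [h3]
  nlinarith [mul_le_mul_of_nonneg_left h2 M.γ_pos.le]

theorem MDP.exists_bellman_fixedPoint [Nonempty A] (M : MDP S A) :
    ∃ v : S → ℝ, M.bellman v = v := by
  -- Monotonicity with a shift, applied in both directions, makes the operator a `γ`-contraction in
  -- the sup norm; the Banach fixed point theorem applies.
  have hc : ContractingWith ⟨M.γ, M.γ_pos.le⟩ M.bellman := by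
    refine ⟨by exact_mod_cast M.γ_lt_one, LipschitzWith.of_dist_le_mul fun v w => ?_⟩
    refine (dist_pi_le_iff (mul_nonneg M.γ_pos.le dist_nonneg)).2 fun s => ?_
    have key : ∀ x, |v x - w x| ≤ dist v w := fun x => by
      rw [← Real.dist_eq]; exact dist_le_pi_dist v w x
    have h1 := M.bellman_le_add (v := v) (w := w) (b := dist v w)
      (fun x => by linarith [(abs_le.1 (key x)).2]) s
    have h2 := M.bellman_le_add (v := w) (w := v) (b := dist v w)
      (fun x => by linarith [(abs_le.1 (key x)).1]) s
    rw [Real.dist_eq, abs_le]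
    change -(M.γ * dist v w) ≤ _ ∧ _ ≤ M.γ * dist v w
    constructor <;> linarith
  exact ⟨_, hc.fixedPoint_isFixedPt⟩

variable [DecidableEq S]

theorem MDP.stateMatrix_pow_nonneg (M : MDP S A) (π : Policy S A) (t : ℕ) (s s' : S) :
    0 ≤ (M.stateMatrix π ^ t) s s' := by
  induction t generalizing s with
  | zero => simp only [pow_zero, Matrix.one_apply]; split_ifs <;> norm_num
  | succ t ih =>
    rw [pow_succ', Matrix.mul_apply]
    exact sum_nonneg fun x _ => mul_nonneg (M.stateMatrix_nonneg π s x) (ih x)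

theorem MDP.stateMatrix_pow_sum (M : MDP S A) (π : Policy S A) (t : ℕ) (s : S) :
    ∑ s', (M.stateMatrix π ^ t) s s' = 1 := by
  induction t generalizing s with
  | zero => simp [Matrix.one_apply]
  | succ t ih =>
    simp_rw [pow_succ', Matrix.mul_apply]
    rw [sum_comm]
    simp_rw [← mul_sum, ih, mul_one]
    exact M.stateMatrix_sum π s

/-- The row of a power of the state transition matrix of `π` as a point of the simplex. -/
noncomputable def MDP.statePowRow (M : MDP S A) (π : Policy S A) (t : ℕ) (s : S) :
    stdSimplex ℝ S :=
  ⟨(M.stateMatrix π ^ t) s, M.stateMatrix_pow_nonneg π t s, M.stateMatrix_pow_sum π t s⟩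

theorem MDP.expected_cost_mem (M : MDP S A) (π : Policy S A) (t : ℕ) (s : S) :
    0 ≤ ∑ s', (M.stateMatrix π ^ t) s s' * ∑ a, π s' a * M.c s' a ∧
      ∑ s', (M.stateMatrix π ^ t) s s' * ∑ a, π s' a * M.c s' a ≤ 1 :=
  ⟨le_simplex_sum_mul (M.statePowRow π t s) fun s' => (M.average_cost_mem π s').1,
    simplex_sum_mul_le (M.statePowRow π t s) fun s' => (M.average_cost_mem π s').2⟩

theorem MDP.summable_value (M : MDP S A) (π : Policy S A) (s : S) :
    Summable fun t : ℕ =>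
      M.γ ^ t * ∑ s', (M.stateMatrix π ^ t) s s' * ∑ a, π s' a * M.c s' a := by
  refine Summable.of_nonneg_of_le
    (fun t => mul_nonneg (pow_nonneg M.γ_pos.le t) (M.expected_cost_mem π t s).1)
    (fun t => mul_le_of_le_one_right (pow_nonneg M.γ_pos.le t) (M.expected_cost_mem π t s).2)
    (summable_geometric_of_lt_one M.γ_pos.le M.γ_lt_one)

theorem MDP.value_nonneg (M : MDP S A) (π : Policy S A) (s : S) : 0 ≤ M.value π s :=
  tsum_nonneg fun t => mul_nonneg (pow_nonneg M.γ_pos.le t) (M.expected_cost_mem π t s).1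

theorem MDP.value_le (M : MDP S A) (π : Policy S A) (s : S) : M.value π s ≤ 1 / (1 - M.γ) := by
  rw [one_div, ← tsum_geometric_of_lt_one M.γ_pos.le M.γ_lt_one]
  exact (M.summable_value π s).tsum_le_tsum
    (fun t => mul_le_of_le_one_right (pow_nonneg M.γ_pos.le t) (M.expected_cost_mem π t s).2)
    (summable_geometric_of_lt_one M.γ_pos.le M.γ_lt_one)

/-- The Bellman equation comes from splitting off the term `t = 0` and factoring one transition out
of each remaining matrix power. -/
theorem MDP.value_eq (M : MDP S A) (π : Policy S A) (s : S) :
    M.value π s = ∑ a, π s a * M.c s a + M.γ * ∑ s', M.stateMatrix π s s' * M.value π s' := by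
  rw [MDP.value, (M.summable_value π s).tsum_eq_zero_add]
  congr 1
  · simp [Matrix.one_apply]
  · simp_rw [MDP.value, ← tsum_mul_left]
    rw [← Summable.tsum_finsetSum fun i _ => (M.summable_value π i).mul_left _, ← tsum_mul_left]
    refine tsum_congr fun t => ?_
    rw [pow_succ', pow_succ' (M.stateMatrix π)]
    simp_rw [Matrix.mul_apply, sum_mul]
    rw [sum_comm, mul_assoc, mul_sum]
    congr 1
    refine sum_congr rfl fun x _ => ?_
    rw [mul_sum, mul_left_comm, mul_sum, mul_sum]
    refine sum_congr rfl fun y _ => ?_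
    ring

/-- The action-value function of `π`. -/
noncomputable def MDP.actionValue (M : MDP S A) (π : Policy S A) (s : S) (a : A) : ℝ :=
  M.c s a + M.γ * ∑ s', M.P s a s' * M.value π s'

theorem MDP.value_eq_sum_actionValue (M : MDP S A) (π : Policy S A) (s : S) :
    M.value π s = ∑ a, π s a * M.actionValue π s a := by
  rw [M.value_eq, M.stateMatrix_mulVec, mul_sum, ← sum_add_distrib]
  refine sum_congr rfl fun a _ => ?_
  rw [MDP.actionValue]; ring

theorem MDP.actionValue_nonneg (M : MDP S A) (π : Policy S A) (s : S) (a : A) :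
    0 ≤ M.actionValue π s a :=
  add_nonneg (M.c_nonneg s a)
    (mul_nonneg M.γ_pos.le (le_simplex_sum_mul _ (M.value_nonneg π)))

theorem MDP.actionValue_le (M : MDP S A) (π : Policy S A) (s : S) (a : A) :
    M.actionValue π s a ≤ 1 / (1 - M.γ) := by
  rw [← M.one_add_mul_horizon]
  exact add_le_add (M.c_le_one s a)
    (mul_le_mul_of_nonneg_left (simplex_sum_mul_le _ (M.value_le π)) M.γ_pos.le)

/-- There is an optimal policy which is deterministic, in the sense that its value is attained by
a single action in each state. -/
theorem MDP.exists_isOptimal [Nonempty S] [Nonempty A] (M : MDP S A) :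
    ∃ (π : Policy S A) (g : S → A),
      M.IsOptimal π ∧ ∀ s, M.value π s = M.actionValue π s (g s) := by
  classical
  obtain ⟨v, hv⟩ := M.exists_bellman_fixedPoint
  have hg : ∀ s, ∃ a, v s = M.c s a + M.γ * ∑ s', M.P s a s' * v s' := fun s => by
    obtain ⟨a, -, ha⟩ := exists_mem_eq_inf' univ_nonempty
      fun a => M.c s a + M.γ * ∑ s', M.P s a s' * v s'
    exact ⟨a, by conv_lhs => rw [← hv]
                 exact ha⟩
  choose g hg using hg
  -- The candidate is greedy for the Bellman fixed point `v`. Then `v` is below every value function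
  -- and above that of `π`, both by `nonpos_of_le_discounted`.
  let π : Policy S A := fun s =>
    ⟨fun a => if a = g s then 1 else 0, fun a => by dsimp only; split_ifs <;> norm_num, by simp⟩
  have hπ : ∀ s a, π s a = if a = g s then 1 else 0 := fun s a => rfl
  have hle : ∀ π' s, v s ≤ ∑ a, π' s a * M.c s a + M.γ * ∑ s', M.stateMatrix π' s s' * v s' := by
    intro π' s
    rw [M.stateMatrix_mulVec, mul_sum, ← sum_add_distrib]
    have : v s ≤ ∑ a, π' s a * (M.c s a + M.γ * ∑ s', M.P s a s' * v s') :=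
      le_simplex_sum_mul _ fun a => by
        conv_lhs => rw [← hv]
        exact inf'_le _ (mem_univ a)
    refine this.trans_eq (sum_congr rfl fun a _ => by ring)
  have h1 : ∀ π' s, v s - M.value π' s ≤ 0 := fun π' => by
    refine nonpos_of_le_discounted M.γ_pos.le M.γ_lt_one (M.stateRow π') _ fun s => ?_
    simp_rw [M.stateRow_apply, mul_sub, sum_sub_distrib]
    linarith [hle π' s, M.value_eq π' s]
  have h2 : ∀ s, M.value π s - v s ≤ 0 := by
    refine nonpos_of_le_discounted M.γ_pos.le M.γ_lt_one (M.stateRow π) _ fun s => ?_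
    have h3 := M.value_eq π s
    have h4 : v s = ∑ a, π s a * M.c s a + M.γ * ∑ s', M.stateMatrix π s s' * v s' := by
      rw [M.stateMatrix_mulVec]
      simp [hπ, ← hg]
    simp_rw [M.stateRow_apply, mul_sub, sum_sub_distrib]
    linarith
  exact ⟨π, g, fun π' s => by linarith [h1 π' s, h2 s],
    fun s => by rw [M.value_eq_sum_actionValue]; simp [hπ]⟩

end Basics

/-! ### The KL mirror step as multiplicative weights -/

section Mirror

variable {A : Type*} [Fintype A]

/-- The linear terms of `klFun x = x log x + 1 - x` cancel in the sum because both arguments have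
total mass one. Every summand is now nonnegative and vanishes only at ratio one, which yields Gibbs'
inequality with its equality case. -/
theorem kl_eq_sum_klFun {p q : stdSimplex ℝ A} (hq : ∀ a, 0 < q a) :
    kl p q = ∑ a, q a * InformationTheory.klFun (p a / q a) := by
  have h : ∀ a, q a * InformationTheory.klFun (p a / q a)
      = p a * Real.log (p a / q a) + q a - p a := fun a => by
    have := (hq a).ne'
    rw [InformationTheory.klFun_apply]
    field_simp
  simp_rw [h, sum_sub_distrib, sum_add_distrib, simplex_sum, kl]
  ring

theorem kl_nonneg {p q : stdSimplex ℝ A} (hq : ∀ a, 0 < q a) : 0 ≤ kl p q := by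
  rw [kl_eq_sum_klFun hq]
  exact sum_nonneg fun a _ => mul_nonneg (hq a).le
    (InformationTheory.klFun_nonneg (div_nonneg (simplex_nonneg p a) (hq a).le))

theorem kl_self {q : stdSimplex ℝ A} (hq : ∀ a, 0 < q a) : kl q q = 0 := by
  rw [kl_eq_sum_klFun hq]
  refine sum_eq_zero fun a _ => ?_
  rw [div_self (hq a).ne', InformationTheory.klFun_one, mul_zero]

theorem eq_of_kl_nonpos {p q : stdSimplex ℝ A} (hq : ∀ a, 0 < q a) (h : kl p q ≤ 0) (a : A) :
    p a = q a := by
  have hnn : ∀ a, 0 ≤ p a / q a := fun a => div_nonneg (simplex_nonneg p a) (hq a).le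
  have h0 := le_antisymm h (kl_nonneg hq)
  rw [kl_eq_sum_klFun hq, sum_eq_zero_iff_of_nonneg fun a _ =>
    mul_nonneg (hq a).le (InformationTheory.klFun_nonneg (hnn a))] at h0
  have h1 := (mul_eq_zero.1 (h0 a (mem_univ a))).resolve_left (hq a).ne'
  rw [InformationTheory.klFun_eq_zero_iff (hnn a), div_eq_one_iff_eq (hq a).ne'] at h1
  exact h1

/-- The mirror descent step with the KL divergence is the multiplicative weights update. -/
theorem mirrorStep_apply [Nonempty A] (η : ℝ) (Q : A → ℝ) {q : stdSimplex ℝ A}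
    (hq : ∀ a, 0 < q a) (a : A) :
    mirrorStep η Q q a = q a * Real.exp (-η * Q a) / ∑ b, q b * Real.exp (-η * Q b) := by
  set Z := ∑ b, q b * Real.exp (-η * Q b) with hZ
  have hw : ∀ b, 0 < q b * Real.exp (-η * Q b) := fun b => mul_pos (hq b) (Real.exp_pos _)
  have hZpos : 0 < Z := sum_pos (fun b _ => hw b) univ_nonempty
  let r : stdSimplex ℝ A := ⟨fun b => q b * Real.exp (-η * Q b) / Z,
    fun b => (div_pos (hw b) hZpos).le, by rw [← sum_div, div_self hZpos.ne']⟩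
  have hr : ∀ b, r b = q b * Real.exp (-η * Q b) / Z := fun b => rfl
  have hrpos : ∀ b, 0 < r b := fun b => by rw [hr]; exact div_pos (hw b) hZpos
  -- Completing the divergence: up to the constant `log Z` the objective is the divergence from the
  -- normalized weights `r`, so `r` is its unique minimizer and the choice made by `epsilon` must be
  -- `r`.
  have key : ∀ p : stdSimplex ℝ A,
      η * ∑ b, Q b * p b + kl p q = kl p r - Real.log Z := fun p => by
    have : ∀ b, p b * Real.log (p b / r b)
        = p b * Real.log (p b / q b) + η * (Q b * p b) + p b * Real.log Z := fun b => by
      rcases (simplex_nonneg p b).eq_or_lt with h | h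
      · rw [← h]; simp
      · rw [Real.log_div h.ne' (hrpos b).ne', Real.log_div h.ne' (hq b).ne', hr,
          Real.log_div (hw b).ne' hZpos.ne', Real.log_mul (hq b).ne' (Real.exp_pos _).ne',
          Real.log_exp]
        ring
    simp_rw [kl, this, sum_add_distrib, ← sum_mul, ← mul_sum, simplex_sum]
    ring
  have hmin : ∃ p : stdSimplex ℝ A, ∀ p' : stdSimplex ℝ A,
      η * ∑ a, Q a * p a + kl p q ≤ η * ∑ a, Q a * p' a + kl p' q :=
    ⟨r, fun p' => by rw [key, key, kl_self hrpos]; linarith [kl_nonneg (p := p') hrpos]⟩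
  have hspec := Classical.epsilon_spec hmin r
  change η * ∑ a, Q a * mirrorStep η Q q a + kl (mirrorStep η Q q) q ≤ _ at hspec
  rw [key, key, kl_self hrpos] at hspec
  rw [← hr]
  exact eq_of_kl_nonpos hrpos (by linarith) a

theorem mirrorStep_pos [Nonempty A] (η : ℝ) (Q : A → ℝ) {q : stdSimplex ℝ A}
    (hq : ∀ a, 0 < q a) (a : A) : 0 < mirrorStep η Q q a := by
  rw [mirrorStep_apply η Q hq]
  exact div_pos (mul_pos (hq a) (Real.exp_pos _))
    (sum_pos (fun b _ => mul_pos (hq b) (Real.exp_pos _)) univ_nonempty)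

theorem exp_neg_le_quadratic {x : ℝ} (hx : 0 ≤ x) : Real.exp (-x) ≤ 1 - x + x ^ 2 / 2 := by
  have h1 := Real.quadratic_le_exp_of_nonneg hx
  have h2 : Real.exp (-x) * Real.exp x = 1 := by rw [← Real.exp_add]; simp
  have h3 : Real.exp (-x) * (1 + x + x ^ 2 / 2) ≤ 1 :=
    (mul_le_mul_of_nonneg_left h1 (Real.exp_pos _).le).trans_eq h2
  -- The product on the right equals `1 + x ^ 4 / 4`.
  have h4 : 1 ≤ (1 - x + x ^ 2 / 2) * (1 + x + x ^ 2 / 2) := by nlinarith [sq_nonneg (x ^ 2)]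
  exact le_of_mul_le_mul_right (h3.trans h4) (by positivity)

/-- The one-step regret inequality of the multiplicative weights update. -/
theorem neg_log_mirrorStep_le [Nonempty A] {η B : ℝ} (hη : 0 ≤ η) {Q : A → ℝ}
    (hQ : ∀ a, 0 ≤ Q a) (hQB : ∀ a, Q a ≤ B) {q : stdSimplex ℝ A} (hq : ∀ a, 0 < q a) (a : A) :
    -Real.log (mirrorStep η Q q a)
      ≤ -Real.log (q a) - η * (∑ b, q b * Q b - Q a) + η ^ 2 * B ^ 2 / 2 := by
  have hw : ∀ b, 0 < q b * Real.exp (-η * Q b) := fun b => mul_pos (hq b) (Real.exp_pos _)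
  have hZpos : 0 < ∑ b, q b * Real.exp (-η * Q b) := sum_pos (fun b _ => hw b) univ_nonempty
  have hZ : ∑ b, q b * Real.exp (-η * Q b) ≤ 1 - η * ∑ b, q b * Q b + η ^ 2 * B ^ 2 / 2 := by
    calc ∑ b, q b * Real.exp (-η * Q b)
        ≤ ∑ b, q b * (1 - η * Q b + η ^ 2 * B ^ 2 / 2) := by
          refine sum_le_sum fun b _ => mul_le_mul_of_nonneg_left ?_ (hq b).le
          have h1 := exp_neg_le_quadratic (mul_nonneg hη (hQ b))
          have h2 : (η * Q b) ^ 2 ≤ η ^ 2 * B ^ 2 := by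
            rw [mul_pow]
            exact mul_le_mul_of_nonneg_left (pow_le_pow_left₀ (hQ b) (hQB b) 2) (sq_nonneg η)
          rw [neg_mul]
          linarith
      _ = _ := by
          have h : ∀ b, q b * (1 - η * Q b + η ^ 2 * B ^ 2 / 2)
              = (1 + η ^ 2 * B ^ 2 / 2) * q b - η * (q b * Q b) := fun b => by ring
          simp_rw [h, sum_sub_distrib, ← mul_sum, simplex_sum]
          ring
  -- The update changes `-log q a` by `η Q a + log Z`; the bound `log Z ≤ Z - 1` combines with the
  -- quadratic bound on `Z`.
  have hlog := Real.log_le_sub_one_of_pos hZpos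
  rw [mirrorStep_apply η Q hq, Real.log_div (hw a).ne' hZpos.ne',
    Real.log_mul (hq a).ne' (Real.exp_pos _).ne', Real.log_exp]
  linarith

end Mirror

/-! ### Regret of truncated descent and survival of optimal actions -/

section Regret

variable {S A : Type*} [Fintype S] [Fintype A] [DecidableEq S] [Nonempty A]

/-- `πs` are the first iterates of policy mirror descent, started at the uniform policy, with
estimates `Qs` of the action values in `[0, 1 / (1 - γ)]` that are accurate up to `e` for the
actions of probability at least `τ`, and equal to `1 / (1 - γ)` for all others. -/
structure MDP.TruncatedDescent (M : MDP S A) (η τ e : ℝ) (k : ℕ) (πs : ℕ → Policy S A)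
    (Qs : ℕ → S → A → ℝ) : Prop where
  zero : πs 0 = fun _ => stdSimplex.barycenter
  succ : ∀ i < k, ∀ s, πs (i + 1) s = mirrorStep η (Qs i s) (πs i s)
  nonneg : ∀ i < k, ∀ s a, 0 ≤ Qs i s a
  le : ∀ i < k, ∀ s a, Qs i s a ≤ 1 / (1 - M.γ)
  accurate : ∀ i < k, ∀ s a, τ ≤ πs i s a → |Qs i s a - M.actionValue (πs i) s a| ≤ e
  truncated : ∀ i < k, ∀ s a, ¬τ ≤ πs i s a → Qs i s a = 1 / (1 - M.γ)

variable {M : MDP S A} {η τ e : ℝ} {k : ℕ} {πs : ℕ → Policy S A} {Qs : ℕ → S → A → ℝ}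

theorem MDP.TruncatedDescent.pos (H : M.TruncatedDescent η τ e k πs Qs) {i : ℕ} (hi : i ≤ k)
    (s : S) (a : A) : 0 < πs i s a := by
  induction i generalizing a with
  | zero =>
    rw [H.zero]
    change 0 < ((Fintype.card A : ℝ))⁻¹
    positivity
  | succ i ih =>
    rw [H.succ i hi]
    exact mirrorStep_pos _ _ (ih (by omega)) a

/-- Telescoping the one-step inequality from the uniform policy, where the potential is `log |A|`.
Each step costs `e` twice: once for replacing the estimate of the fixed action `a`, once for the
average under the current policy. -/
theorem MDP.TruncatedDescent.log_bound (H : M.TruncatedDescent η τ e k πs Qs) (hη : 0 ≤ η)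
    (he : 0 ≤ e) {t : ℕ} (ht : t ≤ k) (s : S) (a : A) (ha : ∀ i < t, τ ≤ πs i s a) :
    -Real.log (πs t s a)
        + η * ∑ i ∈ range t, (M.value (πs i) s - M.actionValue (πs i) s a)
      ≤ Real.log (Fintype.card A) + t * (η ^ 2 * (1 / (1 - M.γ)) ^ 2 / 2 + 2 * η * e) := by
  induction t with
  | zero =>
    rw [H.zero]
    change -Real.log ((Fintype.card A : ℝ))⁻¹ + _ ≤ _
    simp [Real.log_inv]
  | succ t ih =>
    have h1 := ih (by omega) fun i hi => ha i (by omega)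
    have h2 := neg_log_mirrorStep_le hη (H.nonneg t ht s) (H.le t ht s)
      (H.pos (Nat.le_of_succ_le ht) s) a
    rw [← H.succ t ht s] at h2
    have h3 := (abs_le.1 (H.accurate t ht s a (ha t (by omega)))).2
    have h4 : M.value (πs t) s ≤ ∑ b, πs t s b * Qs t s b + e := by
      -- Only a lower bound on the estimation error is needed here. For a truncated action the error
      -- is nonnegative, because the estimate is the largest possible action value.
      have : -e ≤ ∑ b, πs t s b * (Qs t s b - M.actionValue (πs t) s b) := by
        refine le_simplex_sum_mul _ fun b => ?_
        by_cases hb : τ ≤ πs t s b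
        · exact (abs_le.1 (H.accurate t ht s b hb)).1
        · rw [H.truncated t ht s b hb]
          linarith [M.actionValue_le (πs t) s b]
      simp_rw [mul_sub, sum_sub_distrib, ← M.value_eq_sum_actionValue] at this
      linarith
    rw [sum_range_succ]
    push_cast
    have h5 := mul_le_mul_of_nonneg_left
      (show M.value (πs t) s - M.actionValue (πs t) s a
        ≤ (∑ b, πs t s b * Qs t s b - Qs t s a) + 2 * e by linarith) hη
    nlinarith

/-- Comparing with the optimal action turns the advantage sum into the cumulative regret minus its
discounted average over successors, because `πstar` attains its value through `g`. The constant `G`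
is tied to `k` rather than `t`, so it serves all times at once. -/
theorem MDP.TruncatedDescent.discounted_bound (H : M.TruncatedDescent η τ e k πs Qs)
    (hη : 0 ≤ η) (he : 0 ≤ e) {πstar : Policy S A} {g : S → A}
    (hg : ∀ s, M.value πstar s = M.actionValue πstar s (g s)) {G : ℝ}
    (hG : Real.log (Fintype.card A) + k * (η ^ 2 * (1 / (1 - M.γ)) ^ 2 / 2 + 2 * η * e) ≤ G)
    {t : ℕ} (ht : t ≤ k) (ha : ∀ i < t, ∀ s, τ ≤ πs i s (g s)) (s : S) :
    -Real.log (πs t s (g s)) + η * ∑ i ∈ range t, (M.value (πs i) s - M.value πstar s)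
      ≤ G + η * (M.γ * ∑ s', M.P s (g s) s' *
        ∑ i ∈ range t, (M.value (πs i) s' - M.value πstar s')) := by
  have h1 := H.log_bound hη he ht s (g s) fun i hi => ha i hi s
  have h2 : (t : ℝ) * (η ^ 2 * (1 / (1 - M.γ)) ^ 2 / 2 + 2 * η * e)
      ≤ k * (η ^ 2 * (1 / (1 - M.γ)) ^ 2 / 2 + 2 * η * e) :=
    mul_le_mul_of_nonneg_right (by exact_mod_cast ht) (by positivity)
  have h3 : ∑ i ∈ range t, (M.value (πs i) s - M.actionValue (πs i) s (g s))
      = ∑ i ∈ range t, (M.value (πs i) s - M.value πstar s)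
        - M.γ * ∑ s', M.P s (g s) s' *
          ∑ i ∈ range t, (M.value (πs i) s' - M.value πstar s') := by
    have : ∀ i, M.value (πs i) s - M.actionValue (πs i) s (g s)
        = (M.value (πs i) s - M.value πstar s)
          - M.γ * ∑ s', M.P s (g s) s' * (M.value (πs i) s' - M.value πstar s') := fun i => by
      simp_rw [mul_sub, sum_sub_distrib]
      rw [hg, MDP.actionValue, MDP.actionValue]
      ring
    simp_rw [this]
    rw [sum_sub_distrib, ← mul_sum, sum_comm]
    simp_rw [mul_sum]
  rw [h3] at h1
  linarith

/-- If the threshold `τ` is small enough, then the actions of a deterministic optimal policy are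
never truncated, and the regret with respect to this policy is bounded. -/
theorem MDP.TruncatedDescent.regret_le [Nonempty S] (H : M.TruncatedDescent η τ e k πs Qs)
    (hη : 0 < η) (he : 0 ≤ e) (hτ : 0 < τ) {πstar : Policy S A} (hopt : M.IsOptimal πstar)
    {g : S → A} (hg : ∀ s, M.value πstar s = M.actionValue πstar s (g s)) {G : ℝ}
    (hG : Real.log (Fintype.card A) + k * (η ^ 2 * (1 / (1 - M.γ)) ^ 2 / 2 + 2 * η * e) ≤ G)
    (hGτ : G / (1 - M.γ) ≤ -Real.log τ) (s : S) :
    ∑ i ∈ range k, (M.value (πs i) s - M.value πstar s) ≤ G / (η * (1 - M.γ)) := by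
  have hγ := M.one_sub_pos
  -- First use of the inequality: discard `-log π_t ≥ 0`. The constant `G / (η (1 - γ))` solves `η x
  -- = G + η γ x`, so the regret minus this constant is dominated by its own discounted average.
  have hupper : ∀ t ≤ k, (∀ i < t, ∀ s, τ ≤ πs i s (g s)) → ∀ s,
      ∑ i ∈ range t, (M.value (πs i) s - M.value πstar s) ≤ G / (η * (1 - M.γ)) := by
    intro t ht ha s
    rw [← sub_nonpos]
    refine nonpos_of_le_discounted M.γ_pos.le M.γ_lt_one (fun s => M.P s (g s))
      (fun s => ∑ i ∈ range t, (M.value (πs i) s - M.value πstar s) - G / (η * (1 - M.γ)))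
      (fun s => ?_) s
    have h1 := H.discounted_bound hη.le he hg hG ht ha s
    have h2 : 0 ≤ -Real.log (πs t s (g s)) := by
      rw [neg_nonneg]
      exact Real.log_nonpos (simplex_nonneg _ _) (simplex_le_one _ _)
    have h3 : ∑ s', M.P s (g s) s' * (∑ i ∈ range t, (M.value (πs i) s' - M.value πstar s')
          - G / (η * (1 - M.γ)))
        = ∑ s', M.P s (g s) s' * ∑ i ∈ range t, (M.value (πs i) s' - M.value πstar s')
          - G / (η * (1 - M.γ)) := by
      simp_rw [fun x y => mul_sub x y (G / (η * (1 - M.γ))), sum_sub_distrib, ← sum_mul,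
        simplex_sum, one_mul]
    have h4 : G = η * (G / (η * (1 - M.γ)) - M.γ * (G / (η * (1 - M.γ)))) := by
      field_simp
    rw [h3]
    refine le_of_mul_le_mul_left ?_ hη
    linarith
  suffices h : ∀ t ≤ k, ∀ s, τ ≤ πs t s (g s) from
    hupper k le_rfl (fun i hi s => h i hi.le s) s
  intro t
  induction t using Nat.strong_induction_on with
  | _ t ih =>
    intro ht s
    have ha : ∀ i < t, ∀ s, τ ≤ πs i s (g s) := fun i hi => ih i hi (by omega)
    have h1 := H.discounted_bound hη.le he hg hG ht ha s
    -- Second use: the regret on the left is nonnegative by optimality and is discarded, leaving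
    -- `-log π_t ≤ G + γ G / (1 - γ) = G / (1 - γ)`.
    have h2 : 0 ≤ ∑ i ∈ range t, (M.value (πs i) s - M.value πstar s) :=
      sum_nonneg fun i _ => sub_nonneg.2 (hopt _ _)
    have h3 := mul_le_mul_of_nonneg_left (simplex_sum_mul_le (M.P s (g s)) (hupper t ht ha))
      (mul_nonneg hη.le M.γ_pos.le)
    have h4 : G + η * M.γ * (G / (η * (1 - M.γ))) = G / (1 - M.γ) := by
      field_simp; ring
    have h5 := mul_nonneg hη.le h2
    exact (Real.log_le_log_iff hτ (H.pos ht s (g s))).1 (by linarith)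

end Regret

/-! ### Finite expectations and Chernoff bounds -/

section Expectation

variable {α β : Type*} [Fintype α] [Fintype β]

/-- The expectation of a real function under a probability mass function on a finite type. -/
noncomputable def pmfExp (p : PMF α) (f : α → ℝ) : ℝ := ∑ a, (p a).toReal * f a

theorem pmf_sum_toReal (p : PMF α) : ∑ a, (p a).toReal = 1 := by
  rw [← ENNReal.toReal_sum fun a _ => p.apply_ne_top a, ← tsum_fintype (L := .unconditional _),
    p.tsum_coe, ENNReal.toReal_one]

theorem pmfExp_const (p : PMF α) (b : ℝ) : (pmfExp p fun _ => b) = b := by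
  rw [pmfExp, ← sum_mul, pmf_sum_toReal, one_mul]

theorem pmfExp_mono (p : PMF α) {f g : α → ℝ} (h : ∀ a, f a ≤ g a) : pmfExp p f ≤ pmfExp p g :=
  sum_le_sum fun a _ => mul_le_mul_of_nonneg_left (h a) ENNReal.toReal_nonneg

theorem pmfExp_le (p : PMF α) {f : α → ℝ} {b : ℝ} (h : ∀ a, f a ≤ b) : pmfExp p f ≤ b :=
  (pmfExp_mono p h).trans_eq (pmfExp_const p b)

theorem le_pmfExp (p : PMF α) {f : α → ℝ} {b : ℝ} (h : ∀ a, b ≤ f a) : b ≤ pmfExp p f :=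
  (pmfExp_const p b).symm.trans_le (pmfExp_mono p h)

theorem pmfExp_add (p : PMF α) (f g : α → ℝ) :
    (pmfExp p fun a => f a + g a) = pmfExp p f + pmfExp p g := by
  simp only [pmfExp, mul_add, sum_add_distrib]

theorem pmfExp_const_mul (p : PMF α) (b : ℝ) (f : α → ℝ) :
    (pmfExp p fun a => b * f a) = b * pmfExp p f := by
  simp only [pmfExp, mul_sum, mul_left_comm]

theorem pmfExp_bind (p : PMF α) (q : α → PMF β) (f : β → ℝ) :
    pmfExp (p.bind q) f = pmfExp p fun a => pmfExp (q a) f := by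
  have h : ∀ b, (p.bind q b).toReal = ∑ a, (p a).toReal * (q a b).toReal := fun b => by
    rw [PMF.bind_apply, tsum_fintype, ENNReal.toReal_sum fun a _ =>
      ENNReal.mul_ne_top (p.apply_ne_top a) ((q a).apply_ne_top b)]
    simp only [ENNReal.toReal_mul]
  simp only [pmfExp, h, sum_mul, mul_sum]
  rw [sum_comm]
  simp only [mul_assoc]

theorem pmfExp_pure (a : α) (f : α → ℝ) : pmfExp (PMF.pure a) f = f a := by
  classical
  simp [pmfExp, PMF.pure_apply, apply_ite ENNReal.toReal]

theorem pmfExp_map (p : PMF α) (g : α → β) (f : β → ℝ) :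
    pmfExp (p.map g) f = pmfExp p fun a => f (g a) := by
  rw [← PMF.bind_pure_comp, pmfExp_bind]
  simp only [Function.comp, pmfExp_pure]

theorem pmfExp_simplexPMF (p : stdSimplex ℝ α) (f : α → ℝ) :
    pmfExp (simplexPMF p) f = ∑ a, p a * f a := by
  refine sum_congr rfl fun a _ => ?_
  rw [simplexPMF, PMF.ofFintype_apply, ENNReal.toReal_ofReal (simplex_nonneg p a)]

/-- Independence in the form needed for exponential moments: the product of sums is expanded over
all tuples. -/
theorem pmfExp_productPMF {ι : Type*} [Fintype ι] [DecidableEq ι] (p : ι → PMF α)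
    (g : ι → α → ℝ) :
    (pmfExp (productPMF p) fun x => ∏ i, g i (x i)) = ∏ i, pmfExp (p i) (g i) := by
  simp only [pmfExp]
  rw [Fintype.prod_sum]
  refine sum_congr rfl fun x _ => ?_
  rw [productPMF, PMF.ofFintype_apply, ENNReal.toReal_prod, prod_mul_distrib]

/-- Markov's inequality. -/
theorem toOuterMeasure_le_pmfExp (p : PMF α) (s : Set α) {f : α → ℝ} (h0 : ∀ a, 0 ≤ f a)
    (h1 : ∀ a ∈ s, 1 ≤ f a) : p.toOuterMeasure s ≤ ENNReal.ofReal (pmfExp p f) := by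
  rw [PMF.toOuterMeasure_apply_fintype, pmfExp, ENNReal.ofReal_sum_of_nonneg fun a _ =>
    mul_nonneg ENNReal.toReal_nonneg (h0 a)]
  refine sum_le_sum fun a _ => ?_
  by_cases ha : a ∈ s
  · rw [Set.indicator_of_mem ha, ENNReal.le_ofReal_iff_toReal_le (p.apply_ne_top a)
      (mul_nonneg ENNReal.toReal_nonneg (h0 a))]
    exact le_mul_of_one_le_right ENNReal.toReal_nonneg (h1 a ha)
  · rw [Set.indicator_of_notMem ha]
    exact zero_le

/-- A Chernoff bound for sums of independent centred random variables with values in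
`[-B, B]`. -/
theorem productPMF_chernoff {m : ℕ} (p : Fin m → PMF α) (Y : Fin m → α → ℝ) {B u : ℝ}
    (hB : 0 < B) (hY : ∀ i a, |Y i a| ≤ B) (hmean : ∀ i, pmfExp (p i) (Y i) = 0)
    (hu : 0 ≤ u) (huB : u ≤ 2 * B) :
    (productPMF p).toOuterMeasure {x | m * u ≤ ∑ i, Y i (x i)}
      ≤ ENNReal.ofReal (Real.exp (-(m * u ^ 2 / (4 * B ^ 2)))) := by
  -- This `r` minimizes the exponent `r ^ 2 B ^ 2 - r u`. The restriction `u ≤ 2 B` gives `r B ≤ 1`,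
  -- the range where `exp x ≤ 1 + x + x ^ 2` is available.
  set r := u / (2 * B ^ 2) with hr
  have hr0 : 0 ≤ r := by positivity
  have hrB : r * B ≤ 1 := by
    rw [hr, div_mul_eq_mul_div, div_le_one (by positivity)]
    nlinarith
  have hone : ∀ i, pmfExp (p i) (fun a => Real.exp (r * Y i a - r * u))
      ≤ Real.exp (r ^ 2 * B ^ 2 - r * u) := fun i => by
    have h1 : ∀ a, Real.exp (r * Y i a - r * u)
        ≤ Real.exp (-(r * u)) * (1 + r ^ 2 * B ^ 2) + Real.exp (-(r * u)) * r * Y i a := by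
      intro a
      have habs : |r * Y i a| ≤ r * B := by
        rw [abs_mul, abs_of_nonneg hr0]
        exact mul_le_mul_of_nonneg_left (hY i a) hr0
      have h2 := (abs_le.1 (Real.abs_exp_sub_one_sub_id_le (habs.trans hrB))).2
      have h3 : (r * Y i a) ^ 2 ≤ r ^ 2 * B ^ 2 := by
        rw [← sq_abs, ← mul_pow]
        exact pow_le_pow_left₀ (abs_nonneg _) habs 2
      rw [sub_eq_neg_add, Real.exp_add]
      have := mul_le_mul_of_nonneg_left
        (show Real.exp (r * Y i a) ≤ 1 + r ^ 2 * B ^ 2 + r * Y i a by linarith)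
        (Real.exp_pos (-(r * u))).le
      linarith
    refine (pmfExp_mono _ h1).trans ?_
    rw [pmfExp_add, pmfExp_const, pmfExp_const_mul, hmean, mul_zero, add_zero,
      sub_eq_neg_add, Real.exp_add]
    exact mul_le_mul_of_nonneg_left (by linarith [Real.add_one_le_exp (r ^ 2 * B ^ 2)])
      (Real.exp_pos _).le
  have hprod : (pmfExp (productPMF p) fun x => ∏ i, Real.exp (r * Y i (x i) - r * u))
      ≤ Real.exp (-(m * u ^ 2 / (4 * B ^ 2))) := by
    rw [pmfExp_productPMF p fun i a => Real.exp (r * Y i a - r * u)]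
    refine (prod_le_prod (fun i _ => le_pmfExp _ fun a => (Real.exp_pos _).le)
      fun i _ => hone i).trans_eq ?_
    rw [prod_const, card_univ, Fintype.card_fin, ← Real.exp_nat_mul]
    congr 1
    rw [hr]
    field_simp
    ring
  refine (toOuterMeasure_le_pmfExp _ _ (fun x => prod_nonneg fun i _ => (Real.exp_pos _).le)
    fun x hx => ?_).trans (ENNReal.ofReal_le_ofReal hprod)
  rw [← Real.exp_sum, Real.one_le_exp_iff, sum_sub_distrib, ← mul_sum, sum_const, card_univ,
    Fintype.card_fin, nsmul_eq_mul]
  have : (m : ℝ) * u ≤ ∑ i, Y i (x i) := hx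
  nlinarith

/-- A two-sided Chernoff bound for the empirical mean of independent random variables with
values in `[0, B]`. -/
theorem productPMF_mean_deviation {m : ℕ} (p : Fin m → PMF α) {f : α → ℝ} {B u : ℝ} (hm : 0 < m)
    (hB : 0 < B) (hf0 : ∀ a, 0 ≤ f a) (hfB : ∀ a, f a ≤ B) (hu : 0 ≤ u) (huB : u ≤ 2 * B) :
    (productPMF p).toOuterMeasure
        {x | u < |1 / (m : ℝ) * ∑ i, f (x i) - 1 / (m : ℝ) * ∑ i, pmfExp (p i) f|}
      ≤ ENNReal.ofReal (2 * Real.exp (-(m * u ^ 2 / (4 * B ^ 2)))) := by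
  have hm' : (0 : ℝ) < m := by exact_mod_cast hm
  have hμ : ∀ i, 0 ≤ pmfExp (p i) f ∧ pmfExp (p i) f ≤ B :=
    fun i => ⟨le_pmfExp _ hf0, pmfExp_le _ hfB⟩
  have h1 := productPMF_chernoff p (fun i a => f a + -pmfExp (p i) f) hB
    (fun i a => abs_le.2 ⟨by linarith [hμ i, hf0 a], by linarith [hμ i, hfB a]⟩)
    (fun i => by rw [pmfExp_add, pmfExp_const]; ring) hu huB
  have h2 := productPMF_chernoff p (fun i a => pmfExp (p i) f + -1 * f a) hB
    (fun i a => abs_le.2 ⟨by linarith [hμ i, hfB a], by linarith [hμ i, hf0 a]⟩)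
    (fun i => by rw [pmfExp_add, pmfExp_const, pmfExp_const_mul]; ring) hu huB
  rw [two_mul, ENNReal.ofReal_add (Real.exp_pos _).le (Real.exp_pos _).le]
  refine le_trans (MeasureTheory.measure_mono ?_)
    ((MeasureTheory.measure_union_le _ _).trans (add_le_add h1 h2))
  intro x hx
  have hx' : u < |1 / (m : ℝ) * ∑ i, f (x i) - 1 / (m : ℝ) * ∑ i, pmfExp (p i) f| := hx
  rw [← mul_sub, abs_mul, abs_of_nonneg (by positivity : 0 ≤ 1 / (m : ℝ)), one_div,
    inv_mul_eq_div, lt_div_iff₀ hm', lt_abs] at hx'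
  rcases hx' with h | h
  · left
    change (m : ℝ) * u ≤ ∑ i, (f (x i) + -pmfExp (p i) f)
    rw [sum_add_distrib, sum_neg_distrib]
    linarith
  · right
    change (m : ℝ) * u ≤ ∑ i, (pmfExp (p i) f + -1 * f (x i))
    rw [sum_add_distrib, ← mul_sum]
    linarith

end Expectation

/-! ### First visit times -/

section HitTime

variable {S A : Type*} {n : ℕ}

theorem hitTime_mem (ξ : Fin n → S × A) (z : S × A) :
    hitTime ξ z = n ∨ ∃ h : hitTime ξ z < n, ξ ⟨hitTime ξ z, h⟩ = z :=
  Nat.sInf_mem (s := {t : ℕ | t = n ∨ ∃ h : t < n, ξ ⟨t, h⟩ = z}) ⟨n, Or.inl rfl⟩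

theorem hitTime_cons_self (ξ : Fin n → S × A) (z : S × A) :
    hitTime (Fin.cons z ξ : Fin (n + 1) → S × A) z = 0 :=
  Nat.sInf_eq_zero.2 (Or.inl (Or.inr ⟨n.succ_pos, rfl⟩))

/-- The default value for no visit is the length, which also grows by one, so the shift holds
whether or not `z` is visited. -/
theorem hitTime_cons_of_ne (ξ : Fin n → S × A) {z₀ z : S × A} (h : z₀ ≠ z) :
    hitTime (Fin.cons z₀ ξ : Fin (n + 1) → S × A) z = hitTime ξ z + 1 := by
  refine le_antisymm (Nat.sInf_le ?_) ?_
  · rcases hitTime_mem ξ z with h1 | ⟨h1, h2⟩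
    · exact Or.inl (by rw [h1])
    · exact Or.inr ⟨by omega, h2⟩
  · rcases hitTime_mem (Fin.cons z₀ ξ : Fin (n + 1) → S × A) z with h1 | ⟨h1, h2⟩
    · rw [h1]
      exact Nat.succ_le_succ (Nat.sInf_le (Or.inl rfl))
    · generalize hitTime (Fin.cons z₀ ξ : Fin (n + 1) → S × A) z = k at h1 h2
      cases k with
      | zero => exact absurd h2 h
      | succ k => exact Nat.succ_le_succ (Nat.sInf_le (Or.inr ⟨by omega, h2⟩))

end HitTime

/-! ### The estimate from one trajectory -/

section Estimate

variable {S A : Type*} [Fintype S]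

/-- The discounted cost of a finite trajectory. -/
noncomputable def MDP.totalCost (M : MDP S A) {n : ℕ} (ξ : Fin n → S × A) : ℝ :=
  ∑ t : Fin n, M.γ ^ (t : ℕ) * M.c (ξ t).1 (ξ t).2

theorem MDP.totalCost_cons (M : MDP S A) {n : ℕ} (z : S × A) (ξ : Fin n → S × A) :
    M.totalCost (Fin.cons z ξ : Fin (n + 1) → S × A) = M.c z.1 z.2 + M.γ * M.totalCost ξ := by
  simp only [MDP.totalCost, Fin.sum_univ_succ, Fin.cons_zero, Fin.cons_succ, Fin.val_zero,
    Fin.val_succ, pow_succ', mul_sum, mul_assoc, pow_zero, one_mul]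

theorem MDP.totalCost_mem (M : MDP S A) {n : ℕ} (ξ : Fin n → S × A) :
    0 ≤ M.totalCost ξ ∧ M.totalCost ξ ≤ 1 / (1 - M.γ) := by
  induction n with
  | zero => simpa [MDP.totalCost] using M.γ_lt_one.le
  | succ n ih =>
    rw [← Fin.cons_self_tail ξ, M.totalCost_cons, ← M.one_add_mul_horizon]
    exact ⟨add_nonneg (M.c_nonneg _ _) (mul_nonneg M.γ_pos.le (ih _).1),
      add_le_add (M.c_le_one _ _) (mul_le_mul_of_nonneg_left (ih _).2 M.γ_pos.le)⟩

theorem MDP.singleEstimate_cons_self (M : MDP S A) {n : ℕ} (z : S × A) (ξ : Fin n → S × A) :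
    M.singleEstimate (Fin.cons z ξ : Fin (n + 1) → S × A) z
      = M.totalCost (Fin.cons z ξ : Fin (n + 1) → S × A) := by
  simp [MDP.singleEstimate, MDP.totalCost, hitTime_cons_self]

/-- Time and first visit time shift together, so the discount exponents do not change; this permits
induction on the trajectory. -/
theorem MDP.singleEstimate_cons_of_ne (M : MDP S A) {n : ℕ} {z₀ z : S × A}
    (ξ : Fin n → S × A) (h : z₀ ≠ z) :
    M.singleEstimate (Fin.cons z₀ ξ : Fin (n + 1) → S × A) z = M.singleEstimate ξ z := by
  simp [MDP.singleEstimate, hitTime_cons_of_ne ξ h, sum_filter, Fin.sum_univ_succ]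

theorem MDP.singleEstimate_mem (M : MDP S A) {n : ℕ} (ξ : Fin n → S × A) (z : S × A) :
    0 ≤ M.singleEstimate ξ z ∧ M.singleEstimate ξ z ≤ 1 / (1 - M.γ) := by
  induction n with
  | zero => simpa [MDP.singleEstimate] using M.γ_lt_one.le
  | succ n ih =>
    rw [← Fin.cons_self_tail ξ]
    by_cases h : ξ 0 = z
    · subst h
      rw [M.singleEstimate_cons_self]
      exact M.totalCost_mem _
    · rw [M.singleEstimate_cons_of_ne _ h]
      exact ih _

end Estimate

/-! ### Bias of the first-visit estimate -/

section Bias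

variable {S A : Type*} [Fintype S] [Fintype A]

theorem MDP.pmfExp_step (M : MDP S A) (π : Policy S A) (z : S × A) (f : S × A → ℝ) :
    pmfExp (M.step π z) f = ∑ s', M.P z.1 z.2 s' * ∑ a', π s' a' * f (s', a') := by
  simp only [MDP.step, pmfExp_bind, pmfExp_map, pmfExp_simplexPMF]

theorem MDP.pmfExp_trajectoryLaw_succ (M : MDP S A) (π : Policy S A) (n : ℕ) (z : S × A)
    (F : (Fin (n + 1) → S × A) → ℝ) :
    pmfExp (M.trajectoryLaw π (n + 1) z) F = pmfExp (M.step π z) fun z' =>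
      pmfExp (M.trajectoryLaw π n z') fun ξ => F (Fin.cons z ξ) := by
  simp only [MDP.trajectoryLaw, pmfExp_bind, pmfExp_map]

open Classical in
/-- The probability that the chain of `π` started at `z₀` avoids `z` at times `0, …, i - 1`. -/
noncomputable def MDP.avoid (M : MDP S A) (π : Policy S A) (z : S × A) :
    ℕ → S × A → ℝ
  | 0, _ => 1
  | i + 1, z₀ => if z₀ = z then 0 else pmfExp (M.step π z₀) (M.avoid π z i)

theorem MDP.avoid_nonneg (M : MDP S A) (π : Policy S A) (z : S × A) (i : ℕ) (z₀ : S × A) :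
    0 ≤ M.avoid π z i z₀ := by
  induction i generalizing z₀ with
  | zero => exact zero_le_one
  | succ i ih =>
    rw [MDP.avoid]
    split_ifs
    · exact le_rfl
    · exact le_pmfExp _ ih

theorem MDP.avoid_le_one (M : MDP S A) (π : Policy S A) (z : S × A) (i : ℕ) (z₀ : S × A) :
    M.avoid π z i z₀ ≤ 1 := by
  induction i generalizing z₀ with
  | zero => exact le_rfl
  | succ i ih =>
    rw [MDP.avoid]
    split_ifs
    · exact zero_le_one
    · exact pmfExp_le _ ih

theorem MDP.avoid_succ_le (M : MDP S A) (π : Policy S A) (z : S × A) (i : ℕ) (z₀ : S × A) :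
    M.avoid π z (i + 1) z₀ ≤ pmfExp (M.step π z₀) (M.avoid π z i) := by
  rw [MDP.avoid]
  split_ifs
  · exact le_pmfExp _ (M.avoid_nonneg π z i)
  · exact le_rfl

theorem MDP.avoid_succ_self (M : MDP S A) (π : Policy S A) (z : S × A) (i : ℕ) :
    M.avoid π z (i + 1) z = 0 := by
  rw [MDP.avoid, if_pos rfl]

theorem MDP.pmfExp_totalCost_succ (M : MDP S A) (π : Policy S A) (n : ℕ) (z : S × A) :
    pmfExp (M.trajectoryLaw π (n + 1) z) M.totalCost = M.c z.1 z.2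
      + M.γ * pmfExp (M.step π z) fun z' => pmfExp (M.trajectoryLaw π n z') M.totalCost := by
  simp only [M.pmfExp_trajectoryLaw_succ, M.totalCost_cons, pmfExp_add, pmfExp_const,
    pmfExp_const_mul]

open Classical in
theorem MDP.pmfExp_singleEstimate_succ (M : MDP S A) (π : Policy S A) (n : ℕ) (z z₀ : S × A) :
    pmfExp (M.trajectoryLaw π (n + 1) z₀) (fun ξ => M.singleEstimate ξ z)
      = if z₀ = z then pmfExp (M.trajectoryLaw π (n + 1) z) M.totalCost
        else pmfExp (M.step π z₀) fun z' =>
          pmfExp (M.trajectoryLaw π n z') fun ξ => M.singleEstimate ξ z := by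
  split_ifs with h
  · subst h
    simp only [M.pmfExp_trajectoryLaw_succ, M.singleEstimate_cons_self]
  · simp only [M.pmfExp_trajectoryLaw_succ, M.singleEstimate_cons_of_ne _ h]

variable [DecidableEq S]

theorem MDP.stateMatrix_pow_succ_mulVec (M : MDP S A) (π : Policy S A) (T : ℕ) (v : S → ℝ)
    (s : S) : ∑ s', (M.stateMatrix π ^ (T + 1)) s s' * v s'
      = ∑ a, π s a * ∑ s₁, M.P s a s₁ * ∑ s', (M.stateMatrix π ^ T) s₁ s' * v s' := by
  rw [← M.stateMatrix_mulVec π fun s₁ => ∑ s', (M.stateMatrix π ^ T) s₁ s' * v s', pow_succ']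
  simp_rw [Matrix.mul_apply, sum_mul, mul_sum]
  rw [sum_comm]
  simp only [mul_assoc]

/-- Visits during the first `T + 1` steps are simply ignored. The split into one state transition,
`T` further ones and a final action draw exposes the `T`-step state law. -/
theorem MDP.avoid_add_le (M : MDP S A) (π : Policy S A) (z : S × A) (T i : ℕ) (z₀ : S × A) :
    M.avoid π z (T + 1 + i) z₀ ≤ ∑ s₁, M.P z₀.1 z₀.2 s₁ *
      ∑ s, (M.stateMatrix π ^ T) s₁ s * ∑ a, π s a * M.avoid π z i (s, a) := by
  induction T generalizing z₀ with
  | zero =>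
    rw [zero_add, add_comm]
    refine (M.avoid_succ_le π z i z₀).trans_eq ?_
    simp [M.pmfExp_step, Matrix.one_apply]
  | succ T ih =>
    rw [show T + 1 + 1 + i = T + 1 + i + 1 by ring]
    refine (M.avoid_succ_le π z _ z₀).trans ((pmfExp_mono _ ih).trans_eq ?_)
    rw [M.pmfExp_step]
    refine sum_congr rfl fun s₁ _ => ?_
    rw [M.stateMatrix_pow_succ_mulVec π T fun s => ∑ a, π s a * M.avoid π z i (s, a)]

/-- After `T + 1` steps the chain sits at `(s, a)` with probability at least `q`, and there the
avoidance probability is zero. That vanishing requires a positive remaining index, hence `i + 1`;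
for the same reason the index in `MDP.avoid_le_pow` ends in `+ 1`. -/
theorem MDP.avoid_contract (M : MDP S A) (π : Policy S A) (s : S) (a : A) {T : ℕ} {q b : ℝ}
    (hb : 0 ≤ b) (hq : ∀ s₁, q ≤ (M.stateMatrix π ^ T) s₁ s * π s a) {i : ℕ}
    (h : ∀ z₀, M.avoid π (s, a) (i + 1) z₀ ≤ b) (z₀ : S × A) :
    M.avoid π (s, a) (T + 1 + (i + 1)) z₀ ≤ b * (1 - q) := by
  classical
  refine (M.avoid_add_le π _ T _ z₀).trans (simplex_sum_mul_le _ fun s₁ => ?_)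
  have hF : ∀ s', ∑ a', π s' a' * M.avoid π (s, a) (i + 1) (s', a')
      ≤ b - if s' = s then b * π s a else 0 := fun s' => by
    split_ifs with hs
    · subst hs
      calc ∑ a', π s' a' * M.avoid π (s', a) (i + 1) (s', a')
          ≤ ∑ a', π s' a' * (b - if a' = a then b else 0) := by
            refine sum_le_sum fun a' _ => mul_le_mul_of_nonneg_left ?_ (simplex_nonneg _ _)
            split_ifs with ha
            · rw [ha, M.avoid_succ_self, sub_self]
            · rw [sub_zero]; exact h _
        _ = b - b * π s' a := by
            simp_rw [mul_sub, sum_sub_distrib, ← sum_mul, simplex_sum]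
            simp [mul_comm]
    · rw [sub_zero]
      exact simplex_sum_mul_le _ fun a' => h _
  calc ∑ s', (M.stateMatrix π ^ T) s₁ s' * ∑ a', π s' a' * M.avoid π (s, a) (i + 1) (s', a')
      ≤ ∑ s', (M.stateMatrix π ^ T) s₁ s' * (b - if s' = s then b * π s a else 0) :=
        sum_le_sum fun s' _ => mul_le_mul_of_nonneg_left (hF s') (M.stateMatrix_pow_nonneg π T _ _)
    _ = b * (1 - (M.stateMatrix π ^ T) s₁ s * π s a) := by
        simp_rw [mul_sub, sum_sub_distrib, ← sum_mul, M.stateMatrix_pow_sum]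
        simp; ring
    _ ≤ b * (1 - q) := mul_le_mul_of_nonneg_left (by linarith [hq s₁]) hb

theorem MDP.avoid_le_pow (M : MDP S A) (π : Policy S A) (s : S) (a : A) {T : ℕ} {q : ℝ}
    (hq1 : q ≤ 1) (hq : ∀ s₁, q ≤ (M.stateMatrix π ^ T) s₁ s * π s a) (j : ℕ) (z₀ : S × A) :
    M.avoid π (s, a) (j * (T + 1) + 1) z₀ ≤ (1 - q) ^ j := by
  induction j generalizing z₀ with
  | zero => rw [pow_zero]; exact M.avoid_le_one _ _ _ _
  | succ j ih =>
    rw [show (j + 1) * (T + 1) + 1 = T + 1 + (j * (T + 1) + 1) by ring, pow_succ]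
    exact M.avoid_contract π s a (pow_nonneg (by linarith) j) hq ih z₀

theorem MDP.actionValue_eq_pmfExp_step (M : MDP S A) (π : Policy S A) (z : S × A) :
    M.actionValue π z.1 z.2
      = M.c z.1 z.2 + M.γ * pmfExp (M.step π z) fun z' => M.actionValue π z'.1 z'.2 := by
  simp only [M.pmfExp_step, ← M.value_eq_sum_actionValue]
  rfl

theorem MDP.totalCost_bias (M : MDP S A) (π : Policy S A) (n : ℕ) (z : S × A) :
    pmfExp (M.trajectoryLaw π n z) M.totalCost ≤ M.actionValue π z.1 z.2 ∧
      M.actionValue π z.1 z.2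
        ≤ pmfExp (M.trajectoryLaw π n z) M.totalCost + M.γ ^ n * (1 / (1 - M.γ)) := by
  induction n generalizing z with
  | zero =>
    have : pmfExp (M.trajectoryLaw π 0 z) M.totalCost = 0 := by
      rw [MDP.trajectoryLaw, pmfExp_pure]
      simp [MDP.totalCost]
    rw [this, pow_zero, one_mul, zero_add]
    exact ⟨M.actionValue_nonneg π _ _, M.actionValue_le π _ _⟩
  | succ n ih =>
    have h1 := mul_le_mul_of_nonneg_left (pmfExp_mono (M.step π z) fun z' => (ih z').1) M.γ_pos.le
    have h2 := mul_le_mul_of_nonneg_left (pmfExp_mono (M.step π z) fun z' => (ih z').2) M.γ_pos.le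
    rw [pmfExp_add, pmfExp_const] at h2
    rw [M.pmfExp_totalCost_succ, M.actionValue_eq_pmfExp_step, pow_succ']
    constructor <;> linarith

/-- The bias is one-sided: stopping at the end of the trajectory, or never visiting `z`, can only
lose nonnegative costs. -/
theorem MDP.pmfExp_singleEstimate_le (M : MDP S A) (π : Policy S A) (n : ℕ) (z z₀ : S × A) :
    pmfExp (M.trajectoryLaw π n z₀) (fun ξ => M.singleEstimate ξ z)
      ≤ M.actionValue π z.1 z.2 := by
  induction n generalizing z₀ with
  | zero =>
    rw [MDP.trajectoryLaw, pmfExp_pure]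
    simpa [MDP.singleEstimate] using M.actionValue_nonneg π z.1 z.2
  | succ n ih =>
    rw [M.pmfExp_singleEstimate_succ]
    split_ifs
    · exact (M.totalCost_bias π (n + 1) z).1
    · exact pmfExp_le _ ih

/-- Either the first visit occurs before time `i`, leaving at least `r` steps and a truncation loss
of at most `γ ^ r / (1 - γ)`, or it does not, and at most the maximal value `1 / (1 - γ)` is lost.
-/
theorem MDP.actionValue_le_pmfExp_singleEstimate (M : MDP S A) (π : Policy S A) (i r : ℕ)
    (z z₀ : S × A) :
    M.actionValue π z.1 z.2
      ≤ pmfExp (M.trajectoryLaw π (i + r) z₀) (fun ξ => M.singleEstimate ξ z)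
        + 1 / (1 - M.γ) * (M.γ ^ r + M.avoid π z i z₀) := by
  have hM := M.horizon_pos
  induction i generalizing z₀ with
  | zero =>
    have h1 : 0 ≤ pmfExp (M.trajectoryLaw π (0 + r) z₀) fun ξ => M.singleEstimate ξ z :=
      le_pmfExp _ fun ξ => (M.singleEstimate_mem ξ z).1
    have h2 := M.actionValue_le π z.1 z.2
    have h3 : 0 ≤ 1 / (1 - M.γ) * M.γ ^ r := mul_nonneg hM.le (pow_nonneg M.γ_pos.le r)
    rw [MDP.avoid]
    linarith
  | succ i ih =>
    rw [show i + 1 + r = i + r + 1 by ring, M.pmfExp_singleEstimate_succ, MDP.avoid]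
    split_ifs
    · refine (M.totalCost_bias π (i + r + 1) z).2.trans ?_
      have := pow_le_pow_of_le_one M.γ_pos.le M.γ_lt_one.le (show r ≤ i + r + 1 by omega)
      nlinarith
    · refine (le_pmfExp (M.step π z₀) ih).trans_eq ?_
      rw [pmfExp_add, pmfExp_const_mul, pmfExp_add, pmfExp_const]

end Bias

/-! ### Accuracy of one batch -/

section Concentration

theorem toOuterMeasure_bind_le {α β : Type*} (p : PMF α) (q : α → PMF β) {s : Set β}
    {c : ENNReal} (h : ∀ a, (q a).toOuterMeasure s ≤ c) : (p.bind q).toOuterMeasure s ≤ c := by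
  rw [PMF.toOuterMeasure_bind_apply]
  calc ∑' a, p a * (q a).toOuterMeasure s ≤ ∑' a, p a * c :=
        ENNReal.tsum_le_tsum fun a => mul_le_mul_right (h a) _
    _ = c := by rw [ENNReal.tsum_mul_right, p.tsum_coe, one_mul]

variable {S A : Type*} [Fintype S]

theorem MDP.omc_mem (M : MDP S A) {m n : ℕ} (hm : 0 < m) (b : Batch S A m n) (z : S × A) :
    0 ≤ M.omc b z ∧ M.omc b z ≤ 1 / (1 - M.γ) := by
  have hm' : (0 : ℝ) < m := by exact_mod_cast hm
  constructor
  · exact mul_nonneg (by positivity) (sum_nonneg fun l _ => (M.singleEstimate_mem (b l) z).1)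
  · have : ∑ l, M.singleEstimate (b l) z ≤ m * (1 / (1 - M.γ)) := by
      simpa using sum_le_card_nsmul univ (fun l => M.singleEstimate (b l) z) _
        fun l _ => (M.singleEstimate_mem (b l) z).2
    rw [MDP.omc, one_div, inv_mul_le_iff₀ hm']
    exact this

variable [Fintype A]

theorem MDP.tomc_mem (M : MDP S A) {m n : ℕ} (hm : 0 < m) (τ : ℝ) (π : Policy S A)
    (b : Batch S A m n) (s : S) (a : A) :
    0 ≤ M.tomc τ π b s a ∧ M.tomc τ π b s a ≤ 1 / (1 - M.γ) := by
  rw [MDP.tomc]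
  split_ifs
  · exact M.omc_mem hm b _
  · exact ⟨M.horizon_pos.le, le_rfl⟩

variable [DecidableEq S]

theorem MDP.batchLaw_deviation (M : MDP S A) (π : Policy S A) {m n : ℕ} (hm : 0 < m)
    (init : PMF (Fin m → S × A)) (z : S × A) {e u : ℝ} (hu : 0 ≤ u)
    (huB : u ≤ 2 * (1 / (1 - M.γ)))
    (hbias : ∀ z₀, M.actionValue π z.1 z.2
      ≤ pmfExp (M.trajectoryLaw π n z₀) (fun ξ => M.singleEstimate ξ z) + e) :
    (M.batchLaw π n init).toOuterMeasure
        {b : Batch S A m n | e + u < |M.omc b z - M.actionValue π z.1 z.2|}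
      ≤ ENNReal.ofReal (2 * Real.exp (-(m * u ^ 2 / (4 * (1 / (1 - M.γ)) ^ 2)))) := by
  -- Conditioning on the starting pairs makes the trajectories independent, though not identically
  -- distributed; the bias bound is uniform in the start, so the law of the starting pairs does not
  -- matter.
  refine toOuterMeasure_bind_le _ _ fun z₀ => ?_
  refine le_trans (MeasureTheory.measure_mono fun b hb => ?_)
    (productPMF_mean_deviation (fun l => M.trajectoryLaw π n (z₀ l)) hm M.horizon_pos
      (fun ξ => (M.singleEstimate_mem ξ z).1) (fun ξ => (M.singleEstimate_mem ξ z).2) hu huB)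
  have hm' : (0 : ℝ) < m := by exact_mod_cast hm
  set μ := 1 / (m : ℝ) * ∑ l, pmfExp (M.trajectoryLaw π n (z₀ l)) fun ξ => M.singleEstimate ξ z
    with hμ
  have h1 : μ ≤ M.actionValue π z.1 z.2 := by
    rw [hμ, one_div, inv_mul_le_iff₀ hm']
    simpa using sum_le_card_nsmul univ
      (fun l => pmfExp (M.trajectoryLaw π n (z₀ l)) fun ξ => M.singleEstimate ξ z) _
      fun l _ => M.pmfExp_singleEstimate_le π n z (z₀ l)
  have h2 : M.actionValue π z.1 z.2 - e ≤ μ := by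
    rw [hμ, one_div, le_inv_mul_iff₀ hm']
    simpa using card_nsmul_le_sum univ
      (fun l => pmfExp (M.trajectoryLaw π n (z₀ l)) fun ξ => M.singleEstimate ξ z)
      (M.actionValue π z.1 z.2 - e) fun l _ => by linarith [hbias (z₀ l)]
  have hb' : e + u < |M.omc b z - M.actionValue π z.1 z.2| := hb
  change u < |M.omc b z - μ|
  rw [lt_abs] at hb' ⊢
  rcases hb' with h | h
  · left; linarith
  · right; linarith

/-- The policy is mixing and exploring, but the estimate from the batch of the value of some
action that is not truncated is off by more than `e`. -/
def MDP.Inaccurate (M : MDP S A) (τ C ρ νmin e : ℝ) {m n : ℕ} (π : Policy S A)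
    (b : Batch S A m n) : Prop :=
  M.MixingExploring π C ρ νmin ∧
    ∃ z : S × A, τ ≤ π z.1 z.2 ∧ e < |M.omc b z - M.actionValue π z.1 z.2|

theorem MDP.batchLaw_inaccurate (M : MDP S A) {τ C ρ νmin e u : ℝ} (π : Policy S A) {m n : ℕ}
    (hm : 0 < m) (init : PMF (Fin m → S × A)) (hu : 0 ≤ u) (huB : u ≤ 2 * (1 / (1 - M.γ)))
    (hbias : M.MixingExploring π C ρ νmin → ∀ z : S × A, τ ≤ π z.1 z.2 → ∀ z₀,
      M.actionValue π z.1 z.2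
        ≤ pmfExp (M.trajectoryLaw π n z₀) (fun ξ => M.singleEstimate ξ z) + e) :
    (M.batchLaw π n init).toOuterMeasure
        {b : Batch S A m n | M.Inaccurate τ C ρ νmin (e + u) π b}
      ≤ Fintype.card (S × A) *
        ENNReal.ofReal (2 * Real.exp (-(m * u ^ 2 / (4 * (1 / (1 - M.γ)) ^ 2)))) := by
  by_cases hmix : M.MixingExploring π C ρ νmin
  · have hsub : {b : Batch S A m n | M.Inaccurate τ C ρ νmin (e + u) π b}
        ⊆ ⋃ z ∈ univ.filter fun z : S × A => τ ≤ π z.1 z.2,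
          {b : Batch S A m n | e + u < |M.omc b z - M.actionValue π z.1 z.2|} := by
      rintro b ⟨-, z, hz, hb⟩
      simp only [Set.mem_iUnion]
      exact ⟨z, by simpa using hz, hb⟩
    refine (MeasureTheory.measure_mono hsub).trans
      ((MeasureTheory.measure_biUnion_finset_le _ _).trans ?_)
    refine (sum_le_card_nsmul _ _ _ fun z hz => M.batchLaw_deviation π hm init z hu huB
      (hbias hmix z (mem_filter.1 hz).2)).trans ?_
    rw [nsmul_eq_mul]
    exact mul_le_mul_left (by exact_mod_cast card_filter_le _ _) _
  -- Because mixing is part of the event, the bound holds for every policy, as the union bound over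
  -- a random sequence of policies requires.
  · have : {b : Batch S A m n | M.Inaccurate τ C ρ νmin (e + u) π b} = ∅ :=
      Set.eq_empty_of_forall_notMem fun b hb => hmix hb.1
    rw [this, MeasureTheory.measure_empty]
    exact zero_le

/-- The minimum is at most the average, and averaging a pointwise regret bound over `θ` preserves
it. -/
theorem MDP.iInf_objective_le (M : MDP S A) {πs : ℕ → Policy S A} {πstar : Policy S A} {k : ℕ}
    (hk : 0 < k) {R : ℝ}
    (hR : ∀ s, ∑ i ∈ range k, (M.value (πs i) s - M.value πstar s) ≤ R) (θ : stdSimplex ℝ S) :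
    (⨅ t : Fin k, M.objective θ (πs t)) - M.objective θ πstar ≤ R / k := by
  have hk' : (0 : ℝ) < k := by exact_mod_cast hk
  have h1 : ∑ i ∈ range k, (M.objective θ (πs i) - M.objective θ πstar) ≤ R := by
    have : ∑ i ∈ range k, (M.objective θ (πs i) - M.objective θ πstar)
        = ∑ s, θ s * ∑ i ∈ range k, (M.value (πs i) s - M.value πstar s) := by
      simp_rw [MDP.objective, ← sum_sub_distrib, ← mul_sub, mul_sum]
      rw [sum_comm]
    rw [this]
    exact simplex_sum_mul_le _ hR
  have h2 : k * ((⨅ t : Fin k, M.objective θ (πs t)) - M.objective θ πstar)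
      ≤ ∑ i ∈ range k, (M.objective θ (πs i) - M.objective θ πstar) := by
    rw [← card_range k, ← nsmul_eq_mul, card_range]
    have := card_nsmul_le_sum (range k) (fun i => M.objective θ (πs i) - M.objective θ πstar)
      ((⨅ t : Fin k, M.objective θ (πs t)) - M.objective θ πstar) fun i hi =>
        sub_le_sub_right (ciInf_le (Set.finite_range fun t : Fin k => M.objective θ (πs t)).bddBelow
          (⟨i, mem_range.1 hi⟩ : Fin k)) _
    rwa [card_range] at this
  rw [le_div_iff₀ hk', mul_comm]
  exact h2.trans h1

end Concentration

/-! ### Union bound over the iterations -/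

section Run

variable {S A : Type*} [Fintype S] [Fintype A] [Nonempty A]

theorem MDP.length_of_mem_support (M : MDP S A) {η τ : ℝ} {m n : ℕ}
    {init : List (Batch S A m n) → PMF (Fin m → S × A)} {k : ℕ} {h : List (Batch S A m n)}
    (hh : h ∈ (M.runLaw η τ init k).support) : h.length = k := by
  induction k generalizing h with
  | zero =>
    rw [MDP.runLaw, PMF.mem_support_pure_iff] at hh
    rw [hh, List.length_nil]
  | succ k ih =>
    rw [MDP.runLaw, PMF.mem_support_bind_iff] at hh
    obtain ⟨h', hh', hh⟩ := hh
    rw [PMF.mem_support_map_iff] at hh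
    obtain ⟨b, -, rfl⟩ := hh
    rw [List.length_append, ih hh', List.length_singleton]

/-- Some batch is bad for the policy with which it was generated. -/
def MDP.HasBadBatch (M : MDP S A) (η τ : ℝ) {m n : ℕ} (bad : Policy S A → Batch S A m n → Prop)
    (h : List (Batch S A m n)) : Prop :=
  ∃ (t : ℕ) (ht : t < h.length), bad (M.iterate η τ h t) h[t]

theorem MDP.hasBadBatch_append (M : MDP S A) {η τ : ℝ} {m n : ℕ}
    {bad : Policy S A → Batch S A m n → Prop} {h : List (Batch S A m n)} {b : Batch S A m n}
    (H : M.HasBadBatch η τ bad (h ++ [b])) :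
    M.HasBadBatch η τ bad h ∨ bad (M.policyAfter η τ h) b := by
  obtain ⟨t, ht, hbad⟩ := H
  rw [List.length_append, List.length_singleton] at ht
  rw [MDP.iterate, List.take_append_of_le_length (by omega)] at hbad
  rcases (Nat.lt_succ_iff_lt_or_eq.1 ht) with h1 | rfl
  · rw [List.getElem_append_left h1] at hbad
    exact Or.inl ⟨t, h1, hbad⟩
  · rw [List.take_length, List.getElem_concat_length rfl] at hbad
    exact Or.inr hbad

/-- Given the past, the new batch is drawn with a determined policy, so the conditional failure
probability is at most `β` whatever happened before. The probabilities add up over the iterations.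
-/
theorem MDP.runLaw_hasBadBatch (M : MDP S A) (η τ : ℝ) {m n : ℕ}
    (init : List (Batch S A m n) → PMF (Fin m → S × A))
    {bad : Policy S A → Batch S A m n → Prop} {β : ENNReal}
    (hβ : ∀ π init, (M.batchLaw π n init).toOuterMeasure {b | bad π b} ≤ β) (k : ℕ) :
    (M.runLaw η τ init k).toOuterMeasure {h | M.HasBadBatch η τ bad h} ≤ k * β := by
  classical
  induction k with
  | zero =>
    rw [MDP.runLaw, PMF.toOuterMeasure_pure_apply, if_neg]
    · exact zero_le
    · rintro ⟨t, ht, -⟩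
      exact absurd ht (Nat.not_lt_zero t)
  | succ k ih =>
    rw [MDP.runLaw, PMF.toOuterMeasure_bind_apply]
    set B : Set (List (Batch S A m n)) := {h | M.HasBadBatch η τ bad h} with hB
    -- A past that is already bad is charged one; otherwise only the new batch can be bad.
    have hone : ∀ h, (((M.batchLaw (M.policyAfter η τ h) n (init h)).map
        fun b => h ++ [b]).toOuterMeasure B) ≤ B.indicator 1 h + β := by
      intro h
      by_cases hh : h ∈ B
      · rw [Set.indicator_of_mem hh]
        refine le_trans ?_ le_self_add
        rw [Pi.one_apply, ← (PMF.toOuterMeasure_apply_eq_one_iff _ _).2 (Set.subset_univ _)]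
        exact MeasureTheory.measure_mono (Set.subset_univ _)
      · rw [Set.indicator_of_notMem hh, zero_add, PMF.toOuterMeasure_map_apply]
        exact le_trans (MeasureTheory.measure_mono fun b hb =>
          (M.hasBadBatch_append hb).resolve_left hh) (hβ _ _)
    calc ∑' h, M.runLaw η τ init k h * _
        ≤ ∑' h, (B.indicator (M.runLaw η τ init k) h + M.runLaw η τ init k h * β) := by
          refine ENNReal.tsum_le_tsum fun h => (mul_le_mul_right (hone h) _).trans_eq ?_
          rw [mul_add]
          by_cases hh : h ∈ B <;> simp [hh]
      _ = (M.runLaw η τ init k).toOuterMeasure B + β := by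
          rw [ENNReal.tsum_add, ENNReal.tsum_mul_right, PMF.tsum_coe, one_mul,
            PMF.toOuterMeasure_apply]
      _ ≤ k * β + β := add_le_add_left ih _
      _ = ((k + 1 : ℕ) : ENNReal) * β := by push_cast; ring

variable [DecidableEq S]

theorem MDP.truncatedDescent_of_not_hasBadBatch (M : MDP S A) {η τ C ρ νmin e : ℝ} {m n k : ℕ}
    (hm : 0 < m) {h : List (Batch S A m n)} (hlen : h.length = k)
    (hmix : ∀ t ≤ k, M.MixingExploring (M.iterate η τ h t) C ρ νmin)
    (hgood : ¬M.HasBadBatch η τ (M.Inaccurate τ C ρ νmin e) h) :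
    ∃ Qs, M.TruncatedDescent η τ e k (M.iterate η τ h) Qs := by
  -- The value `0` beyond the recorded batches is a default; all requirements concern `i < k`, the
  -- length of the list.
  refine ⟨fun i s a => if hi : i < h.length then M.tomc τ (M.iterate η τ h i) h[i] s a else 0,
    ?_, ?_, ?_, ?_, ?_, ?_⟩
  · rw [MDP.iterate, List.take_zero]
    rfl
  · intro i hi s
    rw [← hlen] at hi
    simp only [dif_pos hi]
    rw [MDP.iterate, List.take_succ_eq_append_getElem hi, MDP.policyAfter, List.foldl_append]
    rfl
  · intro i hi s a
    rw [← hlen] at hi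
    simp only [dif_pos hi]
    exact (M.tomc_mem hm _ _ _ _ _).1
  · intro i hi s a
    rw [← hlen] at hi
    simp only [dif_pos hi]
    exact (M.tomc_mem hm _ _ _ _ _).2
  · intro i hi s a hτ
    have hi' := hi
    rw [← hlen] at hi'
    simp only [dif_pos hi', MDP.tomc, if_pos hτ]
    by_contra hcon
    exact hgood ⟨i, hi', hmix i hi.le, (s, a), hτ, not_le.1 hcon⟩
  · intro i hi s a hτ
    rw [← hlen] at hi
    simp only [dif_pos hi, MDP.tomc, if_neg hτ]

/-- The convergence guarantee, with the properties of the parameters on which it relies as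
hypotheses. -/
theorem MDP.le_toOuterMeasure_gapEvent [Nonempty S] (M : MDP S A)
    {η τ C ρ νmin e u δ G : ℝ} {m n k : ℕ}
    {πstar : Policy S A} (hopt : M.IsOptimal πstar) {g : S → A}
    (hg : ∀ s, M.value πstar s = M.actionValue πstar s (g s))
    (hη : 0 < η) (hτ : 0 < τ) (he : 0 ≤ e) (hδ : 0 ≤ δ) (hk : 0 < k) (hm : 0 < m)
    (hu : 0 ≤ u) (huB : u ≤ 2 * (1 / (1 - M.γ)))
    (hbias : ∀ π : Policy S A, M.MixingExploring π C ρ νmin → ∀ z : S × A, τ ≤ π z.1 z.2 → ∀ z₀,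
      M.actionValue π z.1 z.2
        ≤ pmfExp (M.trajectoryLaw π n z₀) (fun ξ => M.singleEstimate ξ z) + e)
    (hfail : k * (Fintype.card (S × A) *
      (2 * Real.exp (-(m * u ^ 2 / (4 * (1 / (1 - M.γ)) ^ 2))))) ≤ δ)
    (hG : Real.log (Fintype.card A)
      + k * (η ^ 2 * (1 / (1 - M.γ)) ^ 2 / 2 + 2 * η * (e + u)) ≤ G)
    (hGτ : G / (1 - M.γ) ≤ -Real.log τ)
    (init : List (Batch S A m n) → PMF (Fin m → S × A))
    (hmix : M.UniformlyMixing η τ init k C ρ νmin) :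
    ENNReal.ofReal (1 - δ) ≤ (M.runLaw η τ init k).toOuterMeasure
      (M.gapEvent η τ m n k πstar (G / (η * (1 - M.γ)) / k)) := by
  set B : Set (List (Batch S A m n)) :=
    {h | M.HasBadBatch η τ (M.Inaccurate τ C ρ νmin (e + u)) h}
  have hB : (M.runLaw η τ init k).toOuterMeasure B ≤ ENNReal.ofReal δ := by
    refine (M.runLaw_hasBadBatch η τ init (fun π init =>
      M.batchLaw_inaccurate π hm init hu huB (hbias π)) k).trans ?_
    refine le_of_eq_of_le ?_ (ENNReal.ofReal_le_ofReal hfail)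
    rw [ENNReal.ofReal_mul (Nat.cast_nonneg _), ENNReal.ofReal_mul (Nat.cast_nonneg _),
      ENNReal.ofReal_natCast, ENNReal.ofReal_natCast]
  -- Every run of positive probability without a bad batch satisfies the gap bound, so the gap event
  -- and the bad event together have probability one.
  have hcover : (M.runLaw η τ init k).support
      ⊆ M.gapEvent η τ m n k πstar (G / (η * (1 - M.γ)) / k) ∪ B := by
    intro h hh
    by_cases hb : h ∈ B
    · exact Or.inr hb
    · left
      intro θ
      obtain ⟨Qs, H⟩ := M.truncatedDescent_of_not_hasBadBatch hm (M.length_of_mem_support hh)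
        (hmix h hh) hb
      exact M.iInf_objective_le hk (H.regret_le hη (add_nonneg he hu) hτ hopt hg hG hGτ) θ
  have h1 := (PMF.toOuterMeasure_apply_eq_one_iff _ _).2 hcover
  rw [ENNReal.ofReal_sub _ hδ, ENNReal.ofReal_one, tsub_le_iff_right, ← h1]
  exact (MeasureTheory.measure_union_le _ _).trans (add_le_add_right hB _)

end Run

/-! ### Identities and inequalities for the prescribed parameters -/

section Parameters

variable {nA k : ℕ} {γ : ℝ}

theorem log_two_le_log_card (hA : 2 ≤ nA) : Real.log 2 ≤ Real.log nA :=
  Real.log_le_log two_pos (by exact_mod_cast hA)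

theorem log_card_gt (hA : 2 ≤ nA) : 0.69 < Real.log nA := by
  linarith [log_two_le_log_card hA, Real.log_two_gt_d9]

theorem noiseLevel_pos (hA : 2 ≤ nA) (hγ : γ < 1) (hk : 0 < k) : 0 < noiseLevel nA γ k := by
  have h1 := log_card_gt hA
  have h2 : 0 < 1 - γ := sub_pos.2 hγ
  have h3 : (0 : ℝ) < k := by exact_mod_cast hk
  have h4 : 0 < Real.log nA := by linarith
  unfold noiseLevel
  positivity

theorem noiseLevel_sq (hA : 2 ≤ nA) :
    noiseLevel nA γ k ^ 2 = (1 / (1 - γ)) ^ 2 * (Real.log nA / (2 * k)) := by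
  have h1 := log_card_gt hA
  have h4 : 0 < Real.log nA := by linarith
  rw [noiseLevel, mul_pow, Real.sq_sqrt (by positivity)]

/-- Expressing the stepsize through the noise level reduces the parameter balance to `k η ε = log
|A| / 2` and `k η ^ 2 / (1 - γ) ^ 2 = log |A| / 2`. -/
theorem stepsize_eq (hγ : γ < 1) :
    stepsize nA γ k = (1 - γ) ^ 2 * noiseLevel nA γ k := by
  have h2 : 0 < 1 - γ := sub_pos.2 hγ
  rw [stepsize, noiseLevel, ← div_div, Real.sqrt_div' _ (sq_nonneg _),
    Real.sqrt_sq (by positivity)]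
  field_simp

theorem stepsize_pos (hA : 2 ≤ nA) (hγ : γ < 1) (hk : 0 < k) : 0 < stepsize nA γ k := by
  rw [stepsize_eq hγ]
  exact mul_pos (pow_pos (sub_pos.2 hγ) 2) (noiseLevel_pos hA hγ hk)

theorem mul_stepsize_mul_noiseLevel (hA : 2 ≤ nA) (hγ : γ < 1) (hk : 0 < k) :
    k * (stepsize nA γ k * noiseLevel nA γ k) = Real.log nA / 2 := by
  have h2 : 0 < 1 - γ := sub_pos.2 hγ
  have h3 : (0 : ℝ) < k := by exact_mod_cast hk
  rw [stepsize_eq hγ, mul_assoc, ← sq, noiseLevel_sq hA]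
  field_simp

theorem mul_stepsize_sq (hA : 2 ≤ nA) (hγ : γ < 1) (hk : 0 < k) :
    k * (stepsize nA γ k ^ 2 * (1 / (1 - γ)) ^ 2) = Real.log nA / 2 := by
  rw [← mul_stepsize_mul_noiseLevel hA hγ hk, stepsize_eq hγ]
  have h2 : 0 < 1 - γ := sub_pos.2 hγ
  field_simp

theorem gap_bound_eq :
    3 * (1 / (1 - γ)) / (1 - γ) * √(2 * Real.log nA / k)
      = 6 * (1 / (1 - γ)) * noiseLevel nA γ k := by
  have : 2 * Real.log nA / k = 2 ^ 2 * (Real.log nA / (2 * k)) := by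
    by_cases h : (k : ℝ) = 0
    · simp [h]
    · field_simp
  rw [this, Real.sqrt_mul (by norm_num), Real.sqrt_sq (by norm_num), noiseLevel]
  ring

theorem threshold_pos (hA : 2 ≤ nA) : 0 < threshold nA γ :=
  Real.rpow_pos_of_pos (by positivity) _

theorem threshold_le_one (hA : 2 ≤ nA) (hγ : γ < 1) : threshold nA γ ≤ 1 := by
  have h2 : 0 < 1 - γ := sub_pos.2 hγ
  refine Real.rpow_le_one_of_one_le_of_nonpos (by exact_mod_cast (by omega : 1 ≤ nA)) ?_
  exact div_nonpos_of_nonpos_of_nonneg (by norm_num) h2.le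

theorem log_threshold (hA : 2 ≤ nA) :
    -Real.log (threshold nA γ) = 2 * Real.log nA / (1 - γ) := by
  rw [threshold, Real.log_rpow (by positivity)]
  ring

theorem inv_threshold : (threshold nA γ)⁻¹ = (nA : ℝ) ^ (2 / (1 - γ)) := by
  rw [threshold, ← Real.rpow_neg (by positivity), neg_div, neg_neg]

variable {C ρ νmin : ℝ}

theorem logb_le_mixTime (hA : 2 ≤ nA) (hγ : γ < 1) (hρ : 0 < ρ) (hρ1 : ρ < 1) :
    Real.logb ρ (νmin / (2 * C)) ≤ mixTime nA γ C ρ νmin := by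
  have h2 : 0 < 1 - γ := sub_pos.2 hγ
  have h3 : Real.logb ρ nA ≤ 0 := by
    have : (1 : ℝ) < nA := by exact_mod_cast (by omega : 1 < nA)
    exact (Real.logb_neg_of_base_lt_one hρ hρ1 this).le
  have h4 : 2 * Real.logb ρ nA / (1 - γ) ≤ 0 :=
    div_nonpos_of_nonpos_of_nonneg (by linarith) h2.le
  -- The term with `log_ρ |A|` is nonpositive and is subtracted, so it only enlarges the mixing
  -- time.
  exact le_trans (by linarith) (Int.le_ceil _)

theorem one_le_mixTime (hA : 2 ≤ nA) (hγ : γ < 1) (hC : 1 ≤ C) (hρ : 0 < ρ) (hρ1 : ρ < 1)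
    (hν : 0 < νmin) (hν1 : νmin ≤ 1) : 1 ≤ mixTime nA γ C ρ νmin := by
  have h1 : 0 < Real.logb ρ (νmin / (2 * C)) :=
    Real.logb_pos_of_base_lt_one hρ hρ1 (by positivity)
      (by rw [div_lt_one (by positivity)]; linarith)
  have h2 := h1.trans_le (logb_le_mixTime hA hγ hρ hρ1)
  have h3 : 0 < mixTime nA γ C ρ νmin := by exact_mod_cast h2
  omega

theorem mul_pow_mixTime_le (hA : 2 ≤ nA) (hγ : γ < 1) (hC : 1 ≤ C) (hρ : 0 < ρ) (hρ1 : ρ < 1)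
    (hν : 0 < νmin) {T : ℕ} (hT : ((T : ℤ)) = mixTime nA γ C ρ νmin) :
    C * ρ ^ T ≤ νmin / 2 := by
  have h1 := logb_le_mixTime (νmin := νmin) (C := C) hA hγ hρ hρ1
  rw [← hT, Int.cast_natCast] at h1
  have h2 : ρ ^ (T : ℝ) ≤ ρ ^ Real.logb ρ (νmin / (2 * C)) :=
    Real.rpow_le_rpow_of_exponent_ge hρ hρ1.le h1
  rw [Real.rpow_natCast, Real.rpow_logb hρ hρ1.ne (by positivity)] at h2
  calc C * ρ ^ T ≤ C * (νmin / (2 * C)) := mul_le_mul_of_nonneg_left h2 (by linarith)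
    _ = νmin / 2 := by field_simp

theorem mixTime_div_le (hA : 2 ≤ nA) (hγ : γ < 1) (hC : 1 ≤ C) (hρ : 0 < ρ) (hρ1 : ρ < 1)
    (hν : 0 < νmin) (hν1 : νmin ≤ 1) :
    (nA : ℝ) ^ (2 / (1 - γ)) ≤
      (mixTime nA γ C ρ νmin : ℝ) / νmin * (nA : ℝ) ^ (2 / (1 - γ)) := by
  have h1 : (1 : ℝ) ≤ mixTime nA γ C ρ νmin := by
    exact_mod_cast one_le_mixTime hA hγ hC hρ hρ1 hν hν1
  refine le_mul_of_one_le_left (by positivity) ?_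
  rw [le_div_iff₀ hν]
  linarith

theorem rpow_le_horizonFactor (hA : 2 ≤ nA) (hγ : γ < 1) (hC : 1 ≤ C) (hρ : 0 < ρ)
    (hρ1 : ρ < 1) (hν : 0 < νmin) (hν1 : νmin ≤ 1) :
    (nA : ℝ) ^ (2 / (1 - γ)) ≤ horizonFactor nA γ C ρ νmin := by
  have h2 : 0 < 1 / (1 - γ) := one_div_pos.2 (sub_pos.2 hγ)
  have := mixTime_div_le hA hγ hC hρ hρ1 hν hν1
  rw [horizonFactor]
  linarith

theorem horizon_le_horizonFactor (hA : 2 ≤ nA) (hγ : γ < 1) (hC : 1 ≤ C) (hρ : 0 < ρ)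
    (hρ1 : ρ < 1) (hν : 0 < νmin) (hν1 : νmin ≤ 1) :
    1 / (1 - γ) ≤ horizonFactor nA γ C ρ νmin := by
  have := mixTime_div_le hA hγ hC hρ hρ1 hν hν1
  have h3 : 0 ≤ (nA : ℝ) ^ (2 / (1 - γ)) := by positivity
  rw [horizonFactor]
  linarith

theorem one_le_log_exp_add (x : ℝ) : 1 ≤ Real.log (Real.exp 1 + |x|) := by
  rw [Real.le_log_iff_exp_le (by positivity)]
  linarith [abs_nonneg x]

theorem log_le_log_exp_add {x y : ℝ} (hx : 0 < x) (h : x ≤ y) :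
    Real.log x ≤ Real.log (Real.exp 1 + |y|) :=
  Real.log_le_log hx (by linarith [Real.exp_pos 1, le_abs_self y])

/-- The trajectory length suffices for the bias to be of the order of `ε`. -/
theorem length_sufficient {D H ε g : ℝ} (hD : 1 ≤ D) (hH : D ≤ H) (hε : 0 < ε) (hε6 : ε < 1 / 6)
    (hA : 2 ≤ nA) (hg : g = Real.log (nA / ε)) :
    1 ≤ Real.log (16 * D / ε) ∧
      5 * H * Real.log (16 * D / ε) ≤ softScale 20 1 (H * g) := by
  have hA' : (2 : ℝ) ≤ nA := by exact_mod_cast hA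
  have hl2 := Real.log_two_gt_d9
  have hl2' := Real.log_two_lt_d9
  have hinv : Real.log (1 / ε) ≤ g := by
    rw [hg]
    exact Real.log_le_log (by positivity) (by gcongr; linarith)
  have h8 : Real.log 8 = 3 * Real.log 2 := by
    rw [show (8 : ℝ) = 2 ^ 3 by norm_num, Real.log_pow]; norm_num
  have h16 : Real.log 16 = 4 * Real.log 2 := by
    rw [show (16 : ℝ) = 2 ^ 4 by norm_num, Real.log_pow]; norm_num
  -- From `ε < 1 / 6` and at least two actions, `nA / ε` exceeds 8, and `log 8 > 2`.
  have hg2 : 2 ≤ g := by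
    have : Real.log 8 ≤ g := by
      rw [hg]
      refine Real.log_le_log (by norm_num) ?_
      rw [le_div_iff₀ hε]
      linarith
    linarith
  have hlogD : 0 ≤ Real.log D := Real.log_nonneg hD
  have heq : Real.log (16 * D / ε) = Real.log 16 + Real.log D + Real.log (1 / ε) := by
    rw [← Real.log_mul (by norm_num) (by positivity), ← Real.log_mul (by positivity)
      (by positivity), mul_one_div]
  have hinv0 : 0 ≤ Real.log (1 / ε) := Real.log_nonneg (by
    rw [le_div_iff₀ hε]; linarith)
  have hL : D ≤ H * g := by nlinarith
  have hℓ := one_le_log_exp_add (H * g)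
  have hDℓ := log_le_log_exp_add (by linarith : 0 < D) hL
  rw [softScale, pow_one]
  set ℓ := Real.log (Real.exp 1 + |H * g|)
  refine ⟨by linarith, ?_⟩
  -- Each part of `log 16 + log D + log (1 / ε)` is a multiple of `g ℓ`: at most 2, 1/2 and 1 times
  -- it, so the factor 4 suffices and `5 * 4 = 20`.
  have hgl : 2 ≤ g * ℓ := by nlinarith
  have key : Real.log (16 * D / ε) ≤ 4 * (g * ℓ) := by
    rw [heq]
    nlinarith
  have := mul_le_mul_of_nonneg_left key (by linarith : 0 ≤ 5 * H)
  linarith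

theorem two_le_card_prod {S A : Type*} [Fintype S] [Fintype A] [Nonempty S]
    (hA : 2 ≤ Fintype.card A) :
    2 ≤ Fintype.card (S × A) := by
  rw [Fintype.card_prod]
  exact hA.trans (Nat.le_mul_of_pos_left _ Fintype.card_pos)

theorem failure_le {nA nZ k m : ℕ} {γ δ : ℝ} (hA : 2 ≤ nA) (hZ : 2 ≤ nZ) (hγ : γ < 1)
    (hδ : 0 < δ) (hδ1 : δ < 1) (hk : 0 < k) (hm : 64 * trajectoryScale nA nZ γ δ k ≤ m) :
    0 < m ∧ k * (nZ * (2 * Real.exp (-(m * (noiseLevel nA γ k / 8) ^ 2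
      / (4 * (1 / (1 - γ)) ^ 2))))) ≤ δ := by
  have hA' : (2 : ℝ) ≤ nA := by exact_mod_cast hA
  have hZ' : (2 : ℝ) ≤ nZ := by exact_mod_cast hZ
  have hk' : (1 : ℝ) ≤ k := by exact_mod_cast hk
  have hε := noiseLevel_pos hA hγ hk
  have hγ' : 0 < 1 - γ := sub_pos.2 hγ
  set ε := noiseLevel nA γ k
  have hx : 1 < 2 * nZ * k / δ := by
    rw [lt_div_iff₀ hδ]
    nlinarith
  have hlog := Real.log_pos hx
  have hsc : trajectoryScale nA nZ γ δ k
      = (nA : ℝ) ^ 2 / ((1 - γ) ^ 2 * ε ^ 2) * Real.log (2 * nZ * k / δ) := rfl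
  have hscale : 0 < trajectoryScale nA nZ γ δ k := by
    rw [hsc]
    positivity
  refine ⟨by exact_mod_cast (by linarith : (0 : ℝ) < m), ?_⟩
  have h1 : Real.log (2 * nZ * k / δ) ≤ m * (ε / 8) ^ 2 / (4 * (1 / (1 - γ)) ^ 2) := by
    have h2 : m * (ε / 8) ^ 2 / (4 * (1 / (1 - γ)) ^ 2) = m * ((1 - γ) ^ 2 * ε ^ 2 / 256) := by
      field_simp; ring
    rw [h2]
    -- The constant 64 over `256 = 4 * 8 ^ 2` leaves `nA ^ 2 / 4`, which is at least one for two or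
    -- more actions.
    calc Real.log (2 * nZ * k / δ) ≤ (nA : ℝ) ^ 2 / 4 * Real.log (2 * nZ * k / δ) :=
          le_mul_of_one_le_left hlog.le (by nlinarith)
      _ = 64 * trajectoryScale nA nZ γ δ k * ((1 - γ) ^ 2 * ε ^ 2 / 256) := by
          rw [hsc]
          field_simp; norm_num
      _ ≤ _ := mul_le_mul_of_nonneg_right hm (by positivity)
  have h3 := Real.exp_le_exp.2 (neg_le_neg h1)
  rw [Real.exp_neg (Real.log _), Real.exp_log (by linarith), inv_div] at h3
  calc _ ≤ k * (nZ * (2 * (δ / (2 * nZ * k)))) := by gcongr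
    _ = δ := by field_simp

end Parameters

/-! ### Bias from mixing, and convergence -/

section MainBound

variable {S A : Type*} [Fintype S] [DecidableEq S] [Fintype A]

theorem MDP.MixingExploring.le_one [Nonempty S] {M : MDP S A} {π : Policy S A} {C ρ νmin : ℝ}
    (h : M.MixingExploring π C ρ νmin) : νmin ≤ 1 := by
  obtain ⟨ν, -, -, h⟩ := h
  obtain ⟨s⟩ := ‹Nonempty S›
  exact (h s).trans (simplex_le_one ν s)

/-- The Monte Carlo estimates from sufficiently long trajectories are nearly unbiased. -/
theorem MDP.MixingExploring.bias_le [Nonempty S] {M : MDP S A} {π : Policy S A} {C ρ νmin : ℝ}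
    (hmix : M.MixingExploring π C ρ νmin) (hA : 2 ≤ Fintype.card A) (hC : 1 ≤ C) (hρ : 0 < ρ)
    (hρ1 : ρ < 1) (hν : 0 < νmin) {ε : ℝ} (hε : 0 < ε) {n : ℕ}
    (hΛ : 1 ≤ Real.log (16 * (1 / (1 - M.γ)) / ε))
    (hn : 5 * horizonFactor (Fintype.card A) M.γ C ρ νmin *
      Real.log (16 * (1 / (1 - M.γ)) / ε) ≤ n)
    (z : S × A) (hz : threshold (Fintype.card A) M.γ ≤ π z.1 z.2) (z₀ : S × A) :
    M.actionValue π z.1 z.2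
      ≤ pmfExp (M.trajectoryLaw π n z₀) (fun ξ => M.singleEstimate ξ z) + ε / 8 := by
  have hν1 := hmix.le_one
  have hγ := M.γ_lt_one
  have hD := M.one_le_horizon
  have htm1 := one_le_mixTime hA hγ hC hρ hρ1 hν hν1
  -- Off by one on purpose: the mixing bound at time `T` carries `ρ ^ (T + 1)`, and a block of the
  -- state-action chain has `T + 1` steps.
  obtain ⟨T, hT⟩ : ∃ T : ℕ, ((T + 1 : ℕ) : ℤ) = mixTime (Fintype.card A) M.γ C ρ νmin :=
    ⟨(mixTime (Fintype.card A) M.γ C ρ νmin - 1).toNat, by omega⟩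
  have hCρ := mul_pow_mixTime_le hA hγ hC hρ hρ1 hν hT
  have hτ0 := threshold_pos (γ := M.γ) hA
  have hτ1 := threshold_le_one hA hγ
  have hTr : (mixTime (Fintype.card A) M.γ C ρ νmin : ℝ) = T + 1 := by
    rw [← hT]; push_cast; ring
  rw [horizonFactor, ← inv_threshold, hTr] at hn
  set τ := threshold (Fintype.card A) M.γ
  set D := 1 / (1 - M.γ) with hDdef
  set Λ := Real.log (16 * D / ε) with hΛdef
  set q := νmin * τ / 2 with hqdef
  have hντ : 0 < νmin * τ := mul_pos hν hτ0
  have hντ1 : νmin * τ ≤ 1 := mul_le_one₀ hν1 hτ0.le hτ1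
  have hq0 : 0 < q := by positivity
  have hq1 : q ≤ 1 := by linarith
  -- Half of the stationary mass survives after `T` state transitions, and the untruncated action
  -- contributes the factor `τ`.
  have hq : ∀ s₁, q ≤ (M.stateMatrix π ^ T) s₁ z.1 * π z.1 z.2 := fun s₁ => by
    obtain ⟨ν, -, hconv, hmin⟩ := hmix
    have h1 : |(M.stateMatrix π ^ T) s₁ z.1 - ν z.1| ≤ νmin / 2 :=
      (single_le_sum (f := fun s => |(M.stateMatrix π ^ T) s₁ s - ν s|)
        (fun _ _ => abs_nonneg _) (mem_univ z.1)).trans ((hconv s₁ T).trans hCρ)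
    have h2 : νmin / 2 ≤ (M.stateMatrix π ^ T) s₁ z.1 := by
      linarith [(abs_le.1 h1).1, hmin z.1]
    calc q = νmin / 2 * τ := by rw [hqdef]; ring
      _ ≤ _ := mul_le_mul h2 hz hτ0.le (M.stateMatrix_pow_nonneg _ _ _ _)
  have hexp : Real.exp (-Λ) = ε / (16 * D) := by
    rw [hΛdef, Real.exp_neg, Real.exp_log (by positivity), inv_div]
  -- With `j` blocks and `r` reserved steps, both the probability of a late visit and the truncation
  -- factor are at most `exp (-Λ) = ε / (16 D)`; multiplied by `D` their sum is `ε / 8`.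
  set j := ⌈Λ / q⌉₊ with hj
  set r := ⌈D * Λ⌉₊ with hr
  have hjle : Λ / q ≤ j := Nat.le_ceil _
  have hrle : D * Λ ≤ r := Nat.le_ceil _
  have hjlt : (j : ℝ) < Λ / q + 1 := Nat.ceil_lt_add_one (by positivity)
  have hrlt : (r : ℝ) < D * Λ + 1 := Nat.ceil_lt_add_one (by positivity)
  have hnle : j * (T + 1) + 1 + r ≤ n := by
    have h1 : (j : ℝ) * (T + 1) ≤ 2 * (((T : ℝ) + 1) / νmin * τ⁻¹) * Λ + (T + 1) := by
      have : (Λ / q + 1) * ((T : ℝ) + 1) = 2 * (((T : ℝ) + 1) / νmin * τ⁻¹) * Λ + (T + 1) := by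
        rw [hqdef]; field_simp
      rw [← this]
      exact mul_le_mul_of_nonneg_right hjlt.le (by positivity)
    have h2 : (T : ℝ) + 1 ≤ ((T : ℝ) + 1) / νmin * τ⁻¹ := by
      rw [← div_eq_mul_inv, div_div, le_div_iff₀ hντ]
      exact mul_le_of_le_one_right (by positivity) hντ1
    have h3 : (j * (T + 1) + 1 + r : ℝ) ≤ n := by
      set X := ((T : ℝ) + 1) / νmin * τ⁻¹
      nlinarith
    exact_mod_cast h3
  obtain ⟨r', rfl⟩ := Nat.exists_eq_add_of_le ((Nat.le_add_right _ _).trans hnle)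
  have hr' : r ≤ r' := by omega
  refine (M.actionValue_le_pmfExp_singleEstimate π (j * (T + 1) + 1) r' z z₀).trans
    (add_le_add le_rfl ?_)
  have hγr : M.γ ^ r' ≤ ε / (16 * D) := by
    rw [← hexp]
    calc M.γ ^ r' ≤ M.γ ^ r := pow_le_pow_of_le_one M.γ_pos.le hγ.le hr'
      _ ≤ Real.exp (-(1 - M.γ)) ^ r :=
          pow_le_pow_left₀ M.γ_pos.le (by linarith [Real.add_one_le_exp (-(1 - M.γ))]) r
      _ = Real.exp (-((1 - M.γ) * r)) := by rw [← Real.exp_nat_mul]; ring_nf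
      _ ≤ Real.exp (-Λ) := by
          refine Real.exp_le_exp.2 (neg_le_neg ?_)
          calc Λ = (1 - M.γ) * (D * Λ) := by
                have := M.one_sub_pos
                rw [hDdef]; field_simp
            _ ≤ _ := mul_le_mul_of_nonneg_left hrle M.one_sub_pos.le
  have havoid : M.avoid π z (j * (T + 1) + 1) z₀ ≤ ε / (16 * D) := by
    rw [← hexp]
    calc M.avoid π z (j * (T + 1) + 1) z₀ ≤ (1 - q) ^ j := M.avoid_le_pow π z.1 z.2 hq1 hq j z₀
      _ ≤ Real.exp (-q) ^ j :=
          pow_le_pow_left₀ (by linarith) (by linarith [Real.add_one_le_exp (-q)]) j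
      _ = Real.exp (-(q * j)) := by rw [← Real.exp_nat_mul]; ring_nf
      _ ≤ Real.exp (-Λ) := by
          refine Real.exp_le_exp.2 (neg_le_neg ?_)
          calc Λ = q * (Λ / q) := by field_simp
            _ ≤ _ := mul_le_mul_of_nonneg_left hjle hq0.le
  calc D * (M.γ ^ r' + M.avoid π z (j * (T + 1) + 1) z₀)
      ≤ D * (ε / (16 * D) + ε / (16 * D)) :=
        mul_le_mul_of_nonneg_left (add_le_add hγr havoid) (by linarith)
    _ = ε / 8 := by field_simp; norm_num

/-- Convergence with the prescribed parameters. -/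
theorem MDP.convergence [Nonempty S] [Nonempty A] (M : MDP S A) {πstar : Policy S A}
    (hopt : M.IsOptimal πstar) {g : S → A}
    (hg : ∀ s, M.value πstar s = M.actionValue πstar s (g s))
    (hA : 2 ≤ Fintype.card A) {C ρ νmin δ : ℝ} (hC : 1 ≤ C) (hρ : 0 < ρ) (hρ1 : ρ < 1)
    (hν : 0 < νmin) (hδ : 0 < δ) (hδ1 : δ < 1) {k m n : ℕ} (hk : 0 < k)
    (hm : 64 * trajectoryScale (Fintype.card A) (Fintype.card (S × A)) M.γ δ k ≤ m)
    (hn : softScale 20 1 (lengthScale (Fintype.card A) M.γ C ρ νmin k) ≤ n)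
    (init : List (Batch S A m n) → PMF (Fin m → S × A))
    (hmix : M.UniformlyMixing (stepsize (Fintype.card A) M.γ k)
      (threshold (Fintype.card A) M.γ) init k C ρ νmin) :
    ENNReal.ofReal (1 - δ) ≤ (M.runLaw (stepsize (Fintype.card A) M.γ k)
        (threshold (Fintype.card A) M.γ) init k).toOuterMeasure
      (M.gapEvent (stepsize (Fintype.card A) M.γ k) (threshold (Fintype.card A) M.γ) m n k πstar
        (6 * (1 / (1 - M.γ)) * noiseLevel (Fintype.card A) M.γ k)) := by
  have hγ := M.γ_lt_one
  have hD := M.one_le_horizon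
  have hγ' := M.one_sub_pos
  have hε := noiseLevel_pos hA hγ hk
  have hk' : (0 : ℝ) < k := by exact_mod_cast hk
  have hη := stepsize_pos hA hγ hk
  have hηε := mul_stepsize_mul_noiseLevel hA hγ hk
  have hη2 := mul_stepsize_sq hA hγ hk
  obtain ⟨hm0, hfail⟩ := failure_le hA (two_le_card_prod (S := S) hA) hγ hδ hδ1 hk hm
  set τ := threshold (Fintype.card A) M.γ with hτdef
  set η := stepsize (Fintype.card A) M.γ k with hηdef
  set ε := noiseLevel (Fintype.card A) M.γ k with hεdef
  by_cases hε6 : ε < 1 / 6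
  · have hbound := M.le_toOuterMeasure_gapEvent (G := 2 * Real.log (Fintype.card A)) hopt hg hη
      (threshold_pos hA) (by positivity : 0 ≤ ε / 8) hδ.le hk hm0 (by positivity : 0 ≤ ε / 8)
      (by linarith) (fun π hπ z hz z₀ => by
        have hH := horizon_le_horizonFactor hA hγ hC hρ hρ1 hν hπ.le_one
        obtain ⟨h1, h2⟩ := length_sufficient hD hH hε hε6 hA rfl
        exact hπ.bias_le hA hC hρ hρ1 hν hε h1 (h2.trans hn) z hz z₀) hfail
      (by
        have : k * (η ^ 2 * (1 / (1 - M.γ)) ^ 2 / 2 + 2 * η * (ε / 8 + ε / 8))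
            = k * (η ^ 2 * (1 / (1 - M.γ)) ^ 2) / 2 + k * (η * ε) / 2 := by ring
        rw [this, hηε, hη2]
        linarith [log_card_gt hA])
      (log_threshold hA).ge init hmix
    refine hbound.trans (MeasureTheory.measure_mono fun h hh θ => (hh θ).trans ?_)
    rw [div_div, div_le_iff₀ (by positivity)]
    have : 6 * (1 / (1 - M.γ)) * ε * (η * (1 - M.γ) * k) = 6 * (k * (η * ε)) := by
      field_simp
    rw [this, hηε]
    linarith [log_card_gt hA]
  -- If `ε ≥ 1 / 6`, the claimed bound is at least `1 / (1 - γ)`, and no gap is larger than that.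
  · refine (ENNReal.ofReal_le_one.2 (by linarith)).trans_eq ?_
    symm
    rw [PMF.toOuterMeasure_apply_eq_one_iff]
    intro h _ θ
    have h0 : 0 ≤ M.objective θ πstar := le_simplex_sum_mul θ (M.value_nonneg πstar)
    have h1 : (⨅ t : Fin k, M.objective θ (M.iterate η τ h t)) ≤ 1 / (1 - M.γ) :=
      (ciInf_le (Set.finite_range _).bddBelow (⟨0, hk⟩ : Fin k)).trans
        (simplex_sum_mul_le θ (M.value_le _))
    nlinarith

end MainBound

/-! ### Sample complexity -/

section SampleComplexity

variable {nA nZ : ℕ} {γ ϵ δ : ℝ}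

theorem iterationCount_pos (hA : 2 ≤ nA) (hγ : γ < 1) (hϵ : 0 < ϵ) :
    0 < iterationCount nA γ ϵ := by
  have h1 := log_card_gt hA
  have h2 : 0 < 1 - γ := sub_pos.2 hγ
  exact Nat.ceil_pos.2 (div_pos (by linarith) (by positivity))

theorem le_iterationCount (hγ : γ < 1) :
    18 * (Real.log nA * (1 / (1 - γ)) ^ 4 / ϵ ^ 2) ≤ iterationCount nA γ ϵ := by
  have h2 : 0 < 1 - γ := sub_pos.2 hγ
  refine le_of_eq_of_le ?_ (Nat.le_ceil _)
  field_simp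

theorem half_le_iterationScale (hA : 2 ≤ nA) (hγ0 : 0 < γ) (hγ : γ < 1) (hϵ : 0 < ϵ)
    (hϵ1 : ϵ ≤ 1) : 1 / 2 ≤ Real.log nA * (1 / (1 - γ)) ^ 4 / ϵ ^ 2 := by
  have h1 := log_card_gt hA
  have h2 : 0 < 1 - γ := sub_pos.2 hγ
  have h3 : 1 ≤ (1 / (1 - γ)) ^ 4 := one_le_pow₀ (by rw [le_div_iff₀ h2]; linarith)
  have h4 : ϵ ^ 2 ≤ 1 := pow_le_one₀ hϵ.le hϵ1
  rw [le_div_iff₀ (by positivity)]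
  nlinarith

theorem iterationCount_le (hA : 2 ≤ nA) (hγ0 : 0 < γ) (hγ : γ < 1) (hϵ : 0 < ϵ)
    (hϵ1 : ϵ ≤ 1) :
    (iterationCount nA γ ϵ : ℝ) ≤ 20 * (Real.log nA * (1 / (1 - γ)) ^ 4 / ϵ ^ 2) := by
  have h1 := log_card_gt hA
  have h2 : 0 < 1 - γ := sub_pos.2 hγ
  have h3 := half_le_iterationScale hA hγ0 hγ hϵ hϵ1
  have h4 : (iterationCount nA γ ϵ : ℝ) < 18 * Real.log nA / ((1 - γ) ^ 4 * ϵ ^ 2) + 1 :=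
    Nat.ceil_lt_add_one (div_nonneg (by linarith) (by positivity))
  have h5 : 18 * Real.log nA / ((1 - γ) ^ 4 * ϵ ^ 2)
      = 18 * (Real.log nA * (1 / (1 - γ)) ^ 4 / ϵ ^ 2) := by
    field_simp
  -- Rounding up adds at most one, which is at most twice the scale because the scale is at least `1
  -- / 2`; hence 18 becomes 20.
  linarith

theorem noiseLevel_iterationCount_le (hA : 2 ≤ nA) (hγ : γ < 1) (hϵ : 0 < ϵ) :
    6 * (1 / (1 - γ)) * noiseLevel nA γ (iterationCount nA γ ϵ) ≤ ϵ := by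
  have h1 : 0 < Real.log nA := by linarith [log_card_gt hA]
  have h2 : 0 < 1 - γ := sub_pos.2 hγ
  have hk : (0 : ℝ) < iterationCount nA γ ϵ := by exact_mod_cast iterationCount_pos hA hγ hϵ
  have h3 := le_iterationCount (nA := nA) (ϵ := ϵ) hγ
  refine le_of_sq_le_sq ?_ hϵ.le
  rw [mul_pow, noiseLevel_sq hA]
  have h4 : (6 * (1 / (1 - γ))) ^ 2 * ((1 / (1 - γ)) ^ 2 * (Real.log nA /
      (2 * iterationCount nA γ ϵ)))
      = 18 * (Real.log nA * (1 / (1 - γ)) ^ 4 / ϵ ^ 2) / iterationCount nA γ ϵ * ϵ ^ 2 := by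
    field_simp; norm_num
  rw [h4]
  exact mul_le_of_le_one_left (sq_nonneg ϵ) ((div_le_one hk).2 h3)

/-- The noise level must not be too small either, since `log (nA / ε)` enters the trajectory length.
The constant 7 works because `7 ^ 2 / (2 * 20) > 1`. -/
theorem le_noiseLevel_iterationCount (hA : 2 ≤ nA) (hγ0 : 0 < γ) (hγ : γ < 1) (hϵ : 0 < ϵ)
    (hϵ1 : ϵ ≤ 1) :
    ϵ ≤ 7 * (1 / (1 - γ)) * noiseLevel nA γ (iterationCount nA γ ϵ) := by
  have h1 : 0 < Real.log nA := by linarith [log_card_gt hA]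
  have h2 : 0 < 1 - γ := sub_pos.2 hγ
  have hk' := iterationCount_pos hA hγ hϵ
  have hk : (0 : ℝ) < iterationCount nA γ ϵ := by exact_mod_cast hk'
  have h3 := iterationCount_le hA hγ0 hγ hϵ hϵ1
  have hε := noiseLevel_pos hA hγ hk'
  refine le_of_sq_le_sq ?_ (by positivity)
  rw [mul_pow, noiseLevel_sq hA]
  have h4 : (7 * (1 / (1 - γ))) ^ 2 * ((1 / (1 - γ)) ^ 2 * (Real.log nA /
      (2 * iterationCount nA γ ϵ)))
      = 49 / 40 * (20 * (Real.log nA * (1 / (1 - γ)) ^ 4 / ϵ ^ 2) / iterationCount nA γ ϵ)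
        * ϵ ^ 2 := by
    field_simp; norm_num
  rw [h4]
  refine le_mul_of_one_le_left (sq_nonneg ϵ) ?_
  have := (one_le_div hk).2 h3
  linarith

/-- The logarithm that enters the number of trajectories. -/
theorem log_trajectory_le (hA : 2 ≤ nA) (hZ : 2 ≤ nZ) (hγ0 : 0 < γ) (hγ : γ < 1) (hϵ : 0 < ϵ)
    (hϵ1 : ϵ ≤ 1) (hδ : 0 < δ) (hδ1 : δ < 1) :
    1 ≤ Real.log (36 * nZ * Real.log nA / (δ * (1 - γ) ^ 4)) ∧
    1 ≤ Real.log (2 * nZ * iterationCount nA γ ϵ / δ) ∧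
    Real.log (2 * nZ * iterationCount nA γ ϵ / δ)
      ≤ Real.log (36 * nZ * Real.log nA / (δ * (1 - γ) ^ 4)) + 1 + 2 * Real.log (1 / ϵ) := by
  have h1 := log_card_gt hA
  have h10 : 0 < Real.log nA := by linarith
  have h2 : 0 < 1 - γ := sub_pos.2 hγ
  have hZ' : (2 : ℝ) ≤ nZ := by exact_mod_cast hZ
  have hk : (1 : ℝ) ≤ iterationCount nA γ ϵ := by
    exact_mod_cast iterationCount_pos hA hγ hϵ
  have h3 := iterationCount_le hA hγ0 hγ hϵ hϵ1
  have he := Real.exp_one_lt_d9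
  refine ⟨?_, ?_, ?_⟩
  · rw [Real.le_log_iff_exp_le (by positivity), le_div_iff₀ (by positivity)]
    have h4 : δ * (1 - γ) ^ 4 ≤ 1 := mul_le_one₀ hδ1.le (by positivity)
      (pow_le_one₀ h2.le (by linarith))
    nlinarith [Real.exp_pos 1]
  · rw [Real.le_log_iff_exp_le (by positivity), le_div_iff₀ hδ]
    nlinarith [Real.exp_pos 1]
  · have h5 : 2 * nZ * iterationCount nA γ ϵ / δ
        ≤ 36 * nZ * Real.log nA / (δ * (1 - γ) ^ 4) * Real.exp 1 * (1 / ϵ) ^ 2 := by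
      -- Here `2 * 20 = 36 * (10 / 9)` and `10 / 9 ≤ e`; the factor `e` is the summand 1 in the
      -- logarithmic bound.
      calc 2 * nZ * iterationCount nA γ ϵ / δ
          ≤ 2 * nZ * (20 * (Real.log nA * (1 / (1 - γ)) ^ 4 / ϵ ^ 2)) / δ := by gcongr
        _ = 36 * nZ * Real.log nA / (δ * (1 - γ) ^ 4) * (10 / 9) * (1 / ϵ) ^ 2 := by
            field_simp; norm_num
        _ ≤ _ := by
            gcongr
            linarith [Real.add_one_le_exp 1]
    have h6 := Real.log_le_log (by positivity) h5
    rw [Real.log_mul (by positivity) (by positivity), Real.log_mul (by positivity)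
      (by positivity), Real.log_exp, Real.log_pow] at h6
    exact_mod_cast h6

/-- The logarithm that enters the length of the trajectories. -/
theorem log_length_le (hA : 2 ≤ nA) (hγ0 : 0 < γ) (hγ : γ < 1) (hϵ : 0 < ϵ)
    (hϵ1 : ϵ ≤ 1) :
    0 < Real.log (nA / noiseLevel nA γ (iterationCount nA γ ϵ)) ∧
    Real.log (nA / noiseLevel nA γ (iterationCount nA γ ϵ))
      ≤ 2.1 + Real.log (1 / (1 - γ)) + Real.log (nA / ϵ) := by
  have h2 : 0 < 1 - γ := sub_pos.2 hγ
  have hA' : (2 : ℝ) ≤ nA := by exact_mod_cast hA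
  have hε := noiseLevel_pos hA hγ (iterationCount_pos hA hγ hϵ)
  have h3 := noiseLevel_iterationCount_le hA hγ hϵ
  have h4 := le_noiseLevel_iterationCount hA hγ0 hγ hϵ hϵ1
  have hD : 1 ≤ 1 / (1 - γ) := by rw [le_div_iff₀ h2]; linarith
  set ε := noiseLevel nA γ (iterationCount nA γ ϵ)
  constructor
  · refine Real.log_pos ?_
    rw [lt_div_iff₀ hε]
    nlinarith
  · have h5 : nA / ε ≤ 8 * (1 / (1 - γ)) * (nA / ϵ) := by
      rw [div_le_iff₀ hε]
      calc (nA : ℝ) = nA / ϵ * ϵ := by field_simp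
        _ ≤ nA / ϵ * (7 * (1 / (1 - γ)) * ε) := by gcongr
        _ ≤ nA / ϵ * (8 * (1 / (1 - γ)) * ε) := by gcongr; norm_num
        _ = _ := by ring
    have h6 := Real.log_le_log (by positivity) h5
    rw [Real.log_mul (by positivity) (by positivity), Real.log_mul (by norm_num)
      (by positivity), show (8 : ℝ) = 2 ^ 3 by norm_num, Real.log_pow] at h6
    have := Real.log_two_lt_d9
    push_cast at h6
    linarith

/-- The product of the bounds for the three factors of the number of samples, where `ℓ` is the
logarithm of the scale of the number of samples. -/
theorem sample_product_le {a l D ϵ H Y E ℓ k m n : ℝ} (ha : 2 ≤ a) (hl : 0.69 < l) (hD : 1 ≤ D)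
    (hϵ : 0 < ϵ) (hϵ1 : ϵ ≤ 1) (hH : 1 ≤ H) (hY : 1 ≤ Y) (hE : 0.69 < E) (hℓ : 1 ≤ ℓ)
    (hDℓ : D ≤ ℓ) (hm0 : 0 ≤ m) (hn0 : 0 ≤ n)
    (hk : k ≤ 20 * (l * D ^ 4 / ϵ ^ 2))
    (hm : m ≤ 64 * (a ^ 2 * (2 * (20 * (D ^ 4 / ϵ ^ 2)))) * (4 * (Y * ℓ)) + 1)
    (hn : n ≤ 600 * (H * E) * ℓ ^ 2 + 1) :
    k * m * n ≤ 50000000000 * (a ^ 2 * l * D ^ 6 / ϵ ^ 4 * H * Y * E) * ℓ ^ 5 := by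
  have hDϵ : 1 ≤ D ^ 4 / ϵ ^ 2 := by
    rw [le_div_iff₀ (by positivity), one_mul]
    exact (pow_le_one₀ hϵ.le hϵ1).trans (one_le_pow₀ hD)
  have hYℓ : 1 ≤ Y * ℓ := one_le_mul_of_one_le_of_one_le hY hℓ
  have ha2 : 1 ≤ a ^ 2 := one_le_pow₀ (by linarith)
  have hm1 : m ≤ 10241 * (a ^ 2 * (D ^ 4 / ϵ ^ 2) * (Y * ℓ)) := by
    have : 1 ≤ a ^ 2 * (D ^ 4 / ϵ ^ 2) * (Y * ℓ) :=
      one_le_mul_of_one_le_of_one_le (one_le_mul_of_one_le_of_one_le ha2 hDϵ) hYℓ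
    linarith
  have hn1 : n ≤ 602 * (H * E * ℓ ^ 2) := by
    have h1 : 0.69 ≤ H * E := by nlinarith
    have h2 : 1 ≤ ℓ ^ 2 := one_le_pow₀ hℓ
    have : 0.69 ≤ H * E * ℓ ^ 2 := by nlinarith
    linarith
  calc k * m * n
      ≤ 20 * (l * D ^ 4 / ϵ ^ 2) * (10241 * (a ^ 2 * (D ^ 4 / ϵ ^ 2) * (Y * ℓ)))
        * (602 * (H * E * ℓ ^ 2)) := by
        gcongr
    _ = 20 * 10241 * 602 * (a ^ 2 * l * D ^ 6 / ϵ ^ 4 * H * Y * E) * (D ^ 2 * ℓ ^ 3) := by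
        field_simp
    -- The surplus `D ^ 2` is traded for `ℓ ^ 2`, bringing the exponent of the logarithm to 5.
    _ ≤ 50000000000 * (a ^ 2 * l * D ^ 6 / ϵ ^ 4 * H * Y * E) * (ℓ ^ 2 * ℓ ^ 3) := by
        have : 0 < l := by linarith
        have : 0 < E := by linarith
        gcongr
        norm_num
    _ = _ := by ring

/-- The scale of the number of samples dominates several of its factors. -/
theorem factor_le_scale {a l D ϵ H Y E X : ℝ} (ha : 2 ≤ a) (hl : 0.69 < l) (hD : 1 ≤ D)
    (hϵ : 0 < ϵ) (hϵ1 : ϵ ≤ 1) (hH : 1 ≤ H) (hY : 1 ≤ Y) (hE : 0.69 < E)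
    (hX : X = a ^ 2 * l * D ^ 6 / ϵ ^ 4 * H * Y * E) : H * E ≤ X ∧ H ≤ X ∧ 1 / ϵ ≤ X := by
  have hD6 : 1 ≤ D ^ 6 := one_le_pow₀ hD
  have hϵ4 : 1 ≤ 1 / ϵ ^ 4 := by
    rw [le_div_iff₀ (by positivity), one_mul]
    exact pow_le_one₀ hϵ.le hϵ1
  have ha2 : 4 ≤ a ^ 2 := by nlinarith
  have h1 : 1 ≤ a ^ 2 * l := by nlinarith
  have haux : 1 ≤ a ^ 2 * l * E := by
    have : 2.76 ≤ a ^ 2 * l := by nlinarith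
    nlinarith
  refine ⟨?_, ?_, ?_⟩
  · calc H * E ≤ a ^ 2 * l * D ^ 6 * (1 / ϵ ^ 4) * Y * (H * E) :=
          le_mul_of_one_le_left (mul_nonneg (by linarith) (by linarith))
            (one_le_mul_of_one_le_of_one_le (one_le_mul_of_one_le_of_one_le
              (one_le_mul_of_one_le_of_one_le h1 hD6) hϵ4) hY)
      _ = X := by rw [hX]; ring
  · calc H ≤ a ^ 2 * l * E * D ^ 6 * (1 / ϵ ^ 4) * Y * H :=
          le_mul_of_one_le_left (by linarith)
            (one_le_mul_of_one_le_of_one_le (one_le_mul_of_one_le_of_one_le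
              (one_le_mul_of_one_le_of_one_le haux hD6) hϵ4) hY)
      _ = X := by rw [hX]; ring
  · have h4 : 1 / ϵ ≤ 1 / ϵ ^ 4 :=
      one_div_le_one_div_of_le (by positivity) (pow_le_of_le_one hϵ.le hϵ1 (by norm_num))
    calc 1 / ϵ ≤ a ^ 2 * l * E * D ^ 6 * Y * H * (1 / ϵ ^ 4) :=
          h4.trans (le_mul_of_one_le_left (by positivity)
            (one_le_mul_of_one_le_of_one_le (one_le_mul_of_one_le_of_one_le
              (one_le_mul_of_one_le_of_one_le haux hD6) hY) hH))
      _ = X := by rw [hX]; ring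

/-- A bound for the trajectory length in terms of the logarithm of the scale of the number of
samples. -/
theorem softScale_length_le {H E X g c : ℝ} (hH : 1 ≤ H) (hE : 0.69 < E) (hX : H * E ≤ X)
    (hg0 : 0 < g) (hg : g ≤ 2.1 + c + E) (hc : c ≤ Real.log (Real.exp 1 + |X|)) :
    softScale 20 1 (H * g) ≤ 600 * (H * E) * Real.log (Real.exp 1 + |X|) ^ 2 := by
  have hHE : 0 < H * E := mul_pos (by linarith) (by linarith)
  have hX0 : 0 < X := hHE.trans_le hX
  have hℓ := one_le_log_exp_add X
  have he := Real.exp_pos 1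
  have he1 := Real.add_one_le_exp 1
  have hℓX : Real.log (Real.exp 1 + |X|) ≤ Real.exp 1 + X := by
    rw [abs_of_pos hX0]
    linarith [Real.log_le_sub_one_of_pos (by positivity : 0 < Real.exp 1 + X)]
  have hgle : g ≤ 6 * (E * Real.log (Real.exp 1 + |X|)) := by nlinarith
  have hL : H * g ≤ 6 * (H * E) * Real.log (Real.exp 1 + |X|) := by
    have := mul_le_mul_of_nonneg_left hgle (by linarith : 0 ≤ H)
    linarith
  have hL0 : 0 < H * g := mul_pos (by linarith) hg0
  -- The length scale is at most quadratic in `e + X`, so its logarithm is comparable to that of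
  -- `X`.
  have hℓL : Real.log (Real.exp 1 + |H * g|) ≤ 5 * Real.log (Real.exp 1 + |X|) := by
    have h1 : H * g ≤ 6 * X * (Real.exp 1 + X) :=
      hL.trans (mul_le_mul (by linarith) hℓX (by linarith) (by linarith))
    have h3 : Real.exp 1 + |H * g| ≤ 8 * (Real.exp 1 + X) ^ 2 := by
      rw [abs_of_pos hL0]
      nlinarith
    have h4 := Real.log_le_log (by positivity) h3
    rw [Real.log_mul (by norm_num) (by positivity), Real.log_pow,
      show (8 : ℝ) = 2 ^ 3 by norm_num, Real.log_pow] at h4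
    have h5 := Real.log_two_lt_d9
    rw [abs_of_pos hX0] at hℓ ⊢
    push_cast at h4
    linarith
  rw [softScale, pow_one]
  calc 20 * (H * g) * Real.log (Real.exp 1 + |H * g|)
      ≤ 20 * (6 * (H * E) * Real.log (Real.exp 1 + |X|))
        * (5 * Real.log (Real.exp 1 + |X|)) :=
        mul_le_mul (by linarith) hℓL (by linarith [one_le_log_exp_add (H * g)])
          (mul_nonneg (by norm_num) (hL0.le.trans hL))
    _ = _ := by ring

variable {C ρ νmin : ℝ}

theorem sampleScale_eq (hγ : γ < 1) : sampleScale nA nZ γ C ρ νmin δ ϵ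
    = (nA : ℝ) ^ 2 * Real.log nA * (1 / (1 - γ)) ^ 6 / ϵ ^ 4 * horizonFactor nA γ C ρ νmin *
      Real.log (36 * nZ * Real.log nA / (δ * (1 - γ) ^ 4)) * Real.log (nA / ϵ) := by
  have h2 : 0 < 1 - γ := sub_pos.2 hγ
  rw [sampleScale]
  congr 3
  field_simp

theorem sample_count_le (hA : 2 ≤ nA) (hZ : 2 ≤ nZ) (hγ0 : 0 < γ) (hγ : γ < 1) (hϵ : 0 < ϵ)
    (hϵ1 : ϵ ≤ 1) (hδ : 0 < δ) (hδ1 : δ < 1) (hC : 1 ≤ C) (hρ : 0 < ρ) (hρ1 : ρ < 1)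
    (hν : 0 < νmin) (hν1 : νmin ≤ 1) {k m n : ℕ} (hk : k = iterationCount nA γ ϵ)
    (hm : m = ⌈64 * trajectoryScale nA nZ γ δ k⌉₊)
    (hn : n = ⌈softScale 20 1 (lengthScale nA γ C ρ νmin k)⌉₊) :
    ((k * m * n : ℕ) : ℝ)
      ≤ softScale 50000000000 5 (sampleScale nA nZ γ C ρ νmin δ ϵ) := by
  have h2 : 0 < 1 - γ := sub_pos.2 hγ
  have hA' : (2 : ℝ) ≤ nA := by exact_mod_cast hA
  have hl := log_card_gt hA
  have hl0 : 0 < Real.log nA := by linarith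
  have hD : 1 ≤ 1 / (1 - γ) := by rw [le_div_iff₀ h2]; linarith
  obtain ⟨hY, hLZ1, hLZ⟩ := log_trajectory_le hA hZ hγ0 hγ hϵ hϵ1 hδ hδ1
  obtain ⟨hg0, hg⟩ := log_length_le hA hγ0 hγ hϵ hϵ1
  have hkle := iterationCount_le hA hγ0 hγ hϵ hϵ1
  have hkpos := iterationCount_pos hA hγ hϵ
  rw [← hk] at hLZ1 hLZ hg0 hg hkle hkpos
  have hε := noiseLevel_pos hA hγ hkpos
  have hk0 : (0 : ℝ) < k := by exact_mod_cast hkpos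
  have hH1 := horizon_le_horizonFactor hA hγ hC hρ hρ1 hν hν1
  have hH2 := rpow_le_horizonFactor hA hγ hC hρ hρ1 hν hν1
  have hE : Real.log 2 ≤ Real.log (nA / ϵ) :=
    Real.log_le_log two_pos (by rw [le_div_iff₀ hϵ]; nlinarith)
  have hE' : 0.69 < Real.log (nA / ϵ) := by linarith [Real.log_two_gt_d9]
  have hX := sampleScale_eq (nA := nA) (nZ := nZ) (C := C) (ρ := ρ) (νmin := νmin) (δ := δ)
    (ϵ := ϵ) hγ
  have htraj : trajectoryScale nA nZ γ δ k
      = nA ^ 2 * (2 * (k / Real.log nA)) * Real.log (2 * nZ * k / δ) := by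
    rw [trajectoryScale, noiseLevel_sq hA]
    congr 1
    field_simp
  have hlen : lengthScale nA γ C ρ νmin k
      = horizonFactor nA γ C ρ νmin * Real.log (nA / noiseLevel nA γ k) := rfl
  set X := sampleScale nA nZ γ C ρ νmin δ ϵ
  set D := 1 / (1 - γ) with hDdef
  set H := horizonFactor nA γ C ρ νmin
  set Y := Real.log (36 * nZ * Real.log nA / (δ * (1 - γ) ^ 4))
  set E := Real.log (nA / ϵ)
  set LZ := Real.log (2 * nZ * k / δ)
  set g := Real.log (nA / noiseLevel nA γ k)
  have hH : 1 ≤ H := hD.trans hH1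
  obtain ⟨hXHE, hXH, hXϵ⟩ := factor_le_scale hA' hl hD hϵ hϵ1 hH hY hE' hX
  have hℓ := one_le_log_exp_add X
  -- The scale dominates `nA ^ (2 D)`, whose logarithm `2 D log nA` is at least `D`. This is why
  -- powers of the horizon count as logarithmic factors.
  have hℓD : D ≤ Real.log (Real.exp 1 + |X|) := by
    have h1 : D ≤ Real.log ((nA : ℝ) ^ (2 / (1 - γ))) := by
      rw [Real.log_rpow (by linarith), show 2 / (1 - γ) = 2 * D by rw [hDdef]; ring]
      nlinarith
    exact h1.trans (log_le_log_exp_add (by positivity) (hH2.trans hXH))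
  have hℓlogD : Real.log D ≤ Real.log (Real.exp 1 + |X|) :=
    log_le_log_exp_add (by linarith) (hH1.trans hXH)
  have hℓϵ : Real.log (1 / ϵ) ≤ Real.log (Real.exp 1 + |X|) :=
    log_le_log_exp_add (by positivity) hXϵ
  have hlensoft := softScale_length_le hH hE' hXHE hg0 hg hℓlogD
  have hsoft : 0 < softScale 20 1 (H * g) := by
    have := one_le_log_exp_add (H * g)
    rw [softScale, pow_one]
    exact mul_pos (mul_pos (by norm_num) (mul_pos (by linarith) hg0)) (by linarith)
  rw [hlen] at hn
  rw [softScale.eq_def 50000000000]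
  set ℓ := Real.log (Real.exp 1 + |X|)
  have hLZle : LZ ≤ 4 * (Y * ℓ) := by nlinarith
  have hnle : (n : ℝ) ≤ 600 * (H * E) * ℓ ^ 2 + 1 := by
    have h1 : (n : ℝ) < softScale 20 1 (H * g) + 1 := by
      rw [hn]; exact Nat.ceil_lt_add_one hsoft.le
    linarith
  have hmle : (m : ℝ) ≤ 64 * (nA ^ 2 * (2 * (20 * (D ^ 4 / ϵ ^ 2)))) * (4 * (Y * ℓ)) + 1 := by
    have hLZ0 : 0 < LZ := by linarith
    have h1 : (m : ℝ) < 64 * trajectoryScale nA nZ γ δ k + 1 := by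
      rw [hm]; exact Nat.ceil_lt_add_one (by rw [htraj]; positivity)
    have h3 : k / Real.log nA ≤ 20 * (D ^ 4 / ϵ ^ 2) := by
      rw [div_le_iff₀ hl0]
      refine hkle.trans_eq ?_
      ring
    have h4 : nA ^ 2 * (2 * (k / Real.log nA)) * LZ
        ≤ nA ^ 2 * (2 * (20 * (D ^ 4 / ϵ ^ 2))) * (4 * (Y * ℓ)) := by
      gcongr
    rw [htraj] at h1
    linarith
  rw [hX]
  push_cast
  exact sample_product_le hA' hl hD hϵ hϵ1 hH hY hE' hℓ hℓD (Nat.cast_nonneg m)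
    (Nat.cast_nonneg n) hkle hmle hnle

end SampleComplexity

end PolicyMirrorDescent

/-! ### Main theorem -/

open PolicyMirrorDescent
theorem mainTheorem7 :
    ∃ (c₁ c₂ c₃ : ℝ) (p₂ p₃ : ℕ), 0 < c₁ ∧ 0 < c₂ ∧ 0 < c₃ ∧
      ∀ (S A : Type*) [Fintype S] [DecidableEq S] [Nonempty S] [Fintype A] [Nontrivial A]
        (M : MDP S A),
        ∃ πstar : Policy S A, M.IsOptimal πstar ∧
          ∀ (C ρ νmin δ : ℝ), 1 ≤ C → 0 < ρ → ρ < 1 → 0 < νmin → 0 < δ → δ < 1 →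
            (∀ k m n : ℕ, 0 < k → 0 < n →
              c₁ * trajectoryScale (Fintype.card A) (Fintype.card (S × A))
                M.γ δ k ≤ m →
              softScale c₂ p₂
                (lengthScale (Fintype.card A) M.γ C ρ νmin k) ≤ n →
              ∀ (η τ : ℝ),
                η = stepsize (Fintype.card A) M.γ k →
                τ = threshold (Fintype.card A) M.γ →
                ∀ init : List (Batch S A m n) → PMF (Fin m → S × A),
                  M.UniformlyMixing η τ init k C ρ νmin →
                  ENNReal.ofReal (1 - δ) ≤ (M.runLaw η τ init k).toOuterMeasure
                    (M.gapEvent η τ m n k πstar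
                      (3 * (1 / (1 - M.γ)) / (1 - M.γ) *
                        √(2 * Real.log (Fintype.card A) / k)))) ∧
            (∀ ϵ : ℝ, 0 < ϵ → ϵ ≤ 1 → ∀ (k m n : ℕ) (η τ : ℝ),
              k = iterationCount (Fintype.card A) M.γ ϵ →
              m = ⌈c₁ * trajectoryScale (Fintype.card A)
                (Fintype.card (S × A)) M.γ δ k⌉₊ →
              n = ⌈softScale c₂ p₂
                (lengthScale (Fintype.card A) M.γ C ρ νmin k)⌉₊ →
              η = stepsize (Fintype.card A) M.γ k →
              τ = threshold (Fintype.card A) M.γ →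
              ∀ init : List (Batch S A m n) → PMF (Fin m → S × A),
                M.UniformlyMixing η τ init k C ρ νmin →
                ((k * m * n : ℕ) : ℝ) ≤ softScale c₃ p₃
                  (sampleScale (Fintype.card A) (Fintype.card (S × A))
                    M.γ C ρ νmin δ ϵ) ∧
                ENNReal.ofReal (1 - δ) ≤ (M.runLaw η τ init k).toOuterMeasure
                  (M.gapEvent η τ m n k πstar ϵ)) := by 
  refine ⟨64, 20, 50000000000, 1, 5, by norm_num, by norm_num, by norm_num, ?_⟩
  intro S A _ _ _ _ _ M
  have hA : 2 ≤ Fintype.card A := Fintype.one_lt_card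
  have hZ : 2 ≤ Fintype.card (S × A) := two_le_card_prod hA
  obtain ⟨πstar, g, hopt, hg⟩ := M.exists_isOptimal
  refine ⟨πstar, hopt, fun C ρ νmin δ hC hρ hρ1 hν hδ hδ1 => ⟨?_, ?_⟩⟩
  · rintro k m n hk - hm hn η τ rfl rfl init hmix
    rw [gap_bound_eq]
    exact M.convergence hopt hg hA hC hρ hρ1 hν hδ hδ1 hk hm hn init hmix
  · rintro ϵ hϵ hϵ1 k m n η τ hk hm hn rfl rfl init hmix
    -- The sample count is deterministic, but its estimate needs `νmin ≤ 1`; any run of positive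
    -- probability supplies a stationary distribution that forces it.
    have hν1 : νmin ≤ 1 := by
      obtain ⟨h, hh⟩ := (M.runLaw (stepsize (Fintype.card A) M.γ k)
        (threshold (Fintype.card A) M.γ) init k).support_nonempty
      exact (hmix h hh 0 (Nat.zero_le k)).le_one
    have hcount := sample_count_le hA hZ M.γ_pos M.γ_lt_one hϵ hϵ1 hδ hδ1 hC hρ hρ1 hν hν1
      hk hm hn
    have hkpos : 0 < k := hk ▸ iterationCount_pos hA M.γ_lt_one hϵ
    refine ⟨hcount, (M.convergence hopt hg hA hC hρ hρ1 hν hδ hδ1 hkpos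
      (hm ▸ Nat.le_ceil _) (hn ▸ Nat.le_ceil _) init hmix).trans
      (MeasureTheory.measure_mono fun h hh θ => (hh θ).trans ?_)⟩
    rw [hk]
    exact noiseLevel_iterationCount_le hA M.γ_lt_one hϵ
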